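/- A finite simple graph $G=(V,E)$ is an \emph{interval graph} if to each vertex one can assign a nonempty closed bounded interval of $\mathbb{R}$ such that two distinct vertices are adjacent if and only if their intervals intersect. Two perfect matchings of $G$ \emph{differ by a flip} if the symmetric difference of their edge sets is the edge set of a cycle of length four. A \emph{reconfiguration sequence} of length $q$ between perfect matchings $M$ and $N$ is a sequence $M=M_0,M_1,\dots,M_q=N$ of perfect matchings of $G$ in which $M_{i-1}$ and $M_i$ differ by a flip for $1\le i\le q$. \textbf{Corollary.} (1) There is an absolute constant $C$ such that for every interval graph $G=(V,E)$, any two perfect matchings of $G$ are connected by a reconfiguration sequence of length at most $C|V|$. (2) Furthermore, such a sequence can be found in linear time. That is, there are a random access machine program and a constant $C$ such that the following holds for every interval graph $G$ with vertex set $\{0,\dots,n-1\}$ and $m$ edges, and all perfect matchings $M,N$ of $G$. On input $G$ (given by adjacency lists in arbitrary order, without an interval representation or an ordering of the vertices) and $M,N$ (each given by the array of partners of the vertices), the program halts after at most $C(n+m+1)$ steps, and outputs a reconfiguration sequence between $M$ and $N$ of length at most $C\,n$, written as the list of its flips, each flip being given by the four vertices of its $4$-cycle in cyclic order. Here each assignment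 of a constant, copy, addition, truncated subtraction, indirect array read or write, and comparison costs one step, and all numbers written by the program are at most $C(n+m+1)$ (so words have $\log_2(n+m+1)+O(1)$ bits). -/

import Mathlib

namespace IntervalFlip

open scoped symmDiff

/-! ### Interval graphs, flips, reconfiguration sequences -/

/-- `G` is an interval graph: its vertices can be represented by nonempty compact intervals of the
real line such that two distinct vertices are adjacent iff their intervals intersect. -/
def IsIntervalGraph {V : Type*} (G : SimpleGraph V) : Prop :=
  ∃ l r : V → ℝ, (∀ v, l v ≤ r v) ∧
    ∀ u v, u ≠ v → (G.Adj u v ↔ (Set.Icc (l u) (r u) ∩ Set.Icc (l v) (r v)).Nonempty)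

/-- The symmetric difference of (the edge sets of) `M` and `N` is the edge set of the cycle
`a b c d a` of length four. -/
def IsFlip {V : Type*} {G : SimpleGraph V} (M N : G.Subgraph) (a b c d : V) : Prop :=
  [a, b, c, d].Nodup ∧
    M.edgeSet ∆ N.edgeSet = {s(a, b), s(b, c), s(c, d), s(d, a)}

/-- `M` and `N` differ by a flip. -/
def Adjacent {V : Type*} {G : SimpleGraph V} (M N : G.Subgraph) : Prop :=
  ∃ a b c d : V, IsFlip M N a b c d

/-- `S 0, …, S q` is a sequence of perfect matchings from `M` to `N`, consecutive ones differing
by a flip; its length (number of flips) is `q`. -/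
structure IsReconfigurationSequence {V : Type*} {G : SimpleGraph V} (M N : G.Subgraph)
    (q : ℕ) (S : Fin (q + 1) → G.Subgraph) : Prop where
  first : S 0 = M
  last : S (Fin.last q) = N
  perfect : ∀ i, (S i).IsPerfectMatching
  step : ∀ i : Fin q, Adjacent (S i.castSucc) (S i.succ)

/-! ### A random access machine with step count

A program uses finitely many registers and finitely many arrays. It has only additive arithmetic,
indirect access to arrays (the index is the content of a register), and comparisons. Words are the
numbers `0, …, B`: an instruction that would write a larger number has no execution. -/

/-- Memory: the content of each register, and of each cell of each array. -/
structure State where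
  reg : ℕ → ℕ
  arr : ℕ → ℕ → ℕ

/-- Write `k` to register `x`. -/
def State.setReg (s : State) (x k : ℕ) : State :=
  { s with reg := Function.update s.reg x k }

/-- Write `k` to cell `i` of array `a`. -/
def State.setArr (s : State) (a i k : ℕ) : State :=
  { s with arr := Function.update s.arr a (Function.update (s.arr a) i k) }

/-- Programs. The numbers occurring in a program are names of registers (`x y z`) and of arrays
(`a`), and literal constants (`k`). -/
inductive Program where
  | skip : Program
  /-- `x := k` -/
  | const (x k : ℕ) : Program
  /-- `x := y` -/
  | copy (x y : ℕ) : Program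
  /-- `x := y + z` -/
  | add (x y z : ℕ) : Program
  /-- `x := max (y - z) 0` -/
  | sub (x y z : ℕ) : Program
  /-- `x := a[y]` -/
  | load (x a y : ℕ) : Program
  /-- `a[x] := y` -/
  | store (a x y : ℕ) : Program
  /-- `p; q` -/
  | seq (p q : Program) : Program
  /-- `if x < y then p else q` -/
  | ifLt (x y : ℕ) (p q : Program) : Program
  /-- `while x < y do p` -/
  | whileLt (x y : ℕ) (p : Program) : Program

/-- `Exec B p s t s'`: with words `0, …, B`, the program `p` started in `s` halts in `s'` after
exactly `t` steps, where every instruction and every comparison takes one step. -/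
inductive Exec (B : ℕ) : Program → State → ℕ → State → Prop
  | skip (s : State) : Exec B .skip s 1 s
  | const (s : State) (x k : ℕ) (h : k ≤ B) :
      Exec B (.const x k) s 1 (s.setReg x k)
  | copy (s : State) (x y : ℕ) (h : s.reg y ≤ B) :
      Exec B (.copy x y) s 1 (s.setReg x (s.reg y))
  | add (s : State) (x y z : ℕ) (h : s.reg y + s.reg z ≤ B) :
      Exec B (.add x y z) s 1 (s.setReg x (s.reg y + s.reg z))
  | sub (s : State) (x y z : ℕ) (h : s.reg y - s.reg z ≤ B) :
      Exec B (.sub x y z) s 1 (s.setReg x (s.reg y - s.reg z))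
  | load (s : State) (x a y : ℕ) (h : s.arr a (s.reg y) ≤ B) :
      Exec B (.load x a y) s 1 (s.setReg x (s.arr a (s.reg y)))
  | store (s : State) (a x y : ℕ) (h : s.reg y ≤ B) :
      Exec B (.store a x y) s 1 (s.setArr a (s.reg x) (s.reg y))
  | seq {p q : Program} {s s' s'' : State} {t t' : ℕ}
      (hp : Exec B p s t s') (hq : Exec B q s' t' s'') :
      Exec B (.seq p q) s (t + t') s''
  | ifLt_pos {x y : ℕ} {p q : Program} {s s' : State} {t : ℕ}
      (h : s.reg x < s.reg y) (hp : Exec B p s t s') :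
      Exec B (.ifLt x y p q) s (1 + t) s'
  | ifLt_neg {x y : ℕ} {p q : Program} {s s' : State} {t : ℕ}
      (h : ¬ s.reg x < s.reg y) (hq : Exec B q s t s') :
      Exec B (.ifLt x y p q) s (1 + t) s'
  | whileLt_pos {x y : ℕ} {p : Program} {s s' s'' : State} {t t' : ℕ}
      (h : s.reg x < s.reg y) (hp : Exec B p s t s')
      (hw : Exec B (.whileLt x y p) s' t' s'') :
      Exec B (.whileLt x y p) s (1 + t + t') s''
  | whileLt_neg {x y : ℕ} {p : Program} {s : State} (h : ¬ s.reg x < s.reg y) :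
      Exec B (.whileLt x y p) s 1 s

/-! ### Input and output of the algorithm -/

/-- The memory `s` holds exactly the input consisting of a graph `G` on `{0, …, n-1}`, given by
adjacency lists in an arbitrary order, and two perfect matchings `M` and `N`:
register `0` holds `n`; the neighbours of `v`, each once, are in the cells of array `1` with index
at least `array 0 [v]` and less than `array 0 [v+1]`; arrays `2` and `3` hold the partner of each
vertex in `M` and in `N`; everything else is `0`. -/
structure IsInput {n : ℕ} {G : SimpleGraph (Fin n)} (M N : G.Subgraph) (s : State) : Prop where
  card : s.reg 0 = n
  off_zero : s.arr 0 0 = 0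
  off_mono : ∀ v : Fin n, s.arr 0 v ≤ s.arr 0 (v + 1)
  adj : ∀ v : Fin n, Set.BijOn (s.arr 1) (Set.Ico (s.arr 0 v) (s.arr 0 (v + 1)))
    ((fun w : Fin n => (w : ℕ)) '' G.neighborSet v)
  mate_left : ∀ v w : Fin n, M.Adj v w → s.arr 2 v = w
  mate_right : ∀ v w : Fin n, N.Adj v w → s.arr 3 v = w
  reg_zero : ∀ x, x ≠ 0 → s.reg x = 0
  off_rest : ∀ i, n < i → s.arr 0 i = 0
  adj_rest : ∀ i, s.arr 0 n ≤ i → s.arr 1 i = 0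
  mate_left_rest : ∀ i, n ≤ i → s.arr 2 i = 0
  mate_right_rest : ∀ i, n ≤ i → s.arr 3 i = 0
  arr_rest : ∀ a, 4 ≤ a → ∀ i, s.arr a i = 0

/-- The memory `s` holds the sequence `S 0, …, S q` as a list of flips: register `0` holds `q`, and
the `i`-th cells of the arrays `4, 5, 6, 7` hold, in cyclic order, the vertices of the 4-cycle whose
flip leads from `S i` to `S (i+1)`. -/
def IsOutput {n : ℕ} {G : SimpleGraph (Fin n)} (q : ℕ) (S : Fin (q + 1) → G.Subgraph)
    (s : State) : Prop :=
  s.reg 0 = q ∧ ∀ i : Fin q, ∃ a b c d : Fin n,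
    s.arr 4 i = a ∧ s.arr 5 i = b ∧ s.arr 6 i = c ∧ s.arr 7 i = d ∧
      IsFlip (S i.castSucc) (S i.succ) a b c d

end IntervalFlip

/-! Write the two matchings as partner functions `f` and `g`, and let D be the set of vertices where
they differ. Suppose z in D is simple in D: the closed neighbourhoods, within D, of the neighbours
of z form a chain. The partners a = f z and b = g z are such neighbours, and a, b, g a, f b all lie
in D. If the neighbourhood of a is contained in that of b, then g a is adjacent to b, so `g` can
trade its pairs z b and a (g a) for z a and b (g a); in the opposite case `f` makes the mirror-image
flip (`IsMate.exists_flip`). Afterwards `f` and `g` agree at z and at one of a, b, and no new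
disagreement has arisen. Hence at most |V| flips suffice: those of `f` are run forwards, those of
`g` backwards. In an interval graph the vertex of D whose interval ends first is simple
(`IsIntervalModel.isSimple_of_forall_le`), which gives part (1) with constant 1.

For part (2) no intervals are given, and the order of right ends is replaced by a LexBFS ordering.
The last vertex of such an ordering of an interval graph is simple
(`IsIntervalModel.isSimple_of_isLexBFSOrdering`), and prefixes of LexBFS orderings are LexBFS
orderings. So the vertices can be treated from last to first: D always stays inside the current
prefix, whose last vertex is simple. The ordering is computed by partition refinement, at a cost per
round linear in the degree of the pivot (`Partition.Inv.round`, `vc_roundProgram`).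

Which flip is possible is decided by one adjacency test, made by scanning the list of a or b,
whichever is shorter. Whatever the outcome, the cost is at most proportional to the degree of that
one of a, b which now agrees, up to a constant (`vc_agreeProgram`). This vertex leaves D for good,
so all scans together cost O(n + m). -/

namespace IntervalFlip

/-! ### A logic for programs with time bounds -/

/-- All words in the memory are at most `B`. -/
def Bounded (B : ℕ) (s : State) : Prop :=
  (∀ x, s.reg x ≤ B) ∧ ∀ a i, s.arr a i ≤ B

theorem Bounded.setReg {B : ℕ} {s : State} (hs : Bounded B s) (x : ℕ) {k : ℕ} (hk : k ≤ B) :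
    Bounded B (s.setReg x k) := by
  refine ⟨fun y => ?_, hs.2⟩
  by_cases h : y = x
  · subst h; simpa [State.setReg] using hk
  · simpa [State.setReg, h] using hs.1 y

theorem Bounded.setArr {B : ℕ} {s : State} (hs : Bounded B s) (a i : ℕ) {k : ℕ} (hk : k ≤ B) :
    Bounded B (s.setArr a i k) := by
  refine ⟨hs.1, fun b j => ?_⟩
  by_cases h : b = a
  · subst h
    by_cases h' : j = i
    · subst h'; simpa [State.setArr] using hk
    · simpa [State.setArr, h'] using hs.2 b j
  · simpa [State.setArr, h] using hs.2 b j

/-- Started in a memory `s` with words at most `B`, the program `p` halts, and its running time and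
its final memory satisfy `Q`. -/
def Terminates (B : ℕ) (p : Program) (s : State) (Q : ℕ → State → Prop) : Prop :=
  Bounded B s → ∃ t s', Exec B p s t s' ∧ Bounded B s' ∧ Q t s'

theorem Terminates.mono {B : ℕ} {p : Program} {s : State} {Q Q' : ℕ → State → Prop}
    (h : Terminates B p s Q) (hQ : ∀ t s', Q t s' → Q' t s') : Terminates B p s Q' := fun hs =>
  let ⟨t, s', he, hb, hq⟩ := h hs
  ⟨t, s', he, hb, hQ t s' hq⟩

theorem Terminates.seq {B : ℕ} {p q : Program} {s : State} {Q : ℕ → State → Prop}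
    (h : Terminates B p s fun t s' => Terminates B q s' fun t' s'' => Q (t + t') s'') :
    Terminates B (.seq p q) s Q := fun hs =>
  let ⟨_, _, he, hb, hq⟩ := h hs
  let ⟨_, s'', he', hb', hq'⟩ := hq hb
  ⟨_, s'', .seq he he', hb', hq'⟩

/-- A loop rule: `I m s` is an invariant in which `m` bounds the remaining running time. -/
theorem Terminates.whileLt {B x y : ℕ} {p : Program} (I : ℕ → State → Prop)
    (step : ∀ m s, I m s → s.reg x < s.reg y →
      Terminates B p s fun t s' => ∃ m', I m' s' ∧ 1 + t + m' ≤ m) :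
    ∀ m s, I m s → Terminates B (.whileLt x y p) s fun t s' =>
      ∃ m', I m' s' ∧ ¬ s'.reg x < s'.reg y ∧ t + m' ≤ m + 1 := by
  intro m
  induction m using Nat.strong_induction_on with
  | _ m ih =>
    intro s hI hs
    by_cases h : s.reg x < s.reg y
    · obtain ⟨t, s', he, hb, m', hI', hm⟩ := step m s hI h hs
      -- The step charged for the comparison makes `m'` strictly smaller than `m`: the time budget
      -- itself is the termination measure.
      obtain ⟨t', s'', he', hb', m'', hI'', hn, hm'⟩ := ih m' (by omega) s' hI' hb
      exact ⟨_, s'', .whileLt_pos h he he', hb', m'', hI'', hn, by omega⟩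
    · exact ⟨1, s, .whileLt_neg h, hs, m, hI, h, by omega⟩

/-- The verification condition of a program: loops are left as they are. -/
def vc (B : ℕ) : Program → State → (ℕ → State → Prop) → Prop
  | .skip, s, Q => Q 1 s
  | .const x k, s, Q => k ≤ B ∧ Q 1 (s.setReg x k)
  | .copy x y, s, Q => Q 1 (s.setReg x (s.reg y))
  | .add x y z, s, Q => s.reg y + s.reg z ≤ B ∧ Q 1 (s.setReg x (s.reg y + s.reg z))
  | .sub x y z, s, Q => Q 1 (s.setReg x (s.reg y - s.reg z))
  | .load x a y, s, Q => Q 1 (s.setReg x (s.arr a (s.reg y)))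
  | .store a x y, s, Q => Q 1 (s.setArr a (s.reg x) (s.reg y))
  | .seq p q, s, Q => vc B p s fun t s' => vc B q s' fun t' s'' => Q (t + t') s''
  | .ifLt x y p q, s, Q =>
      (s.reg x < s.reg y → vc B p s fun t s' => Q (1 + t) s') ∧
        (¬ s.reg x < s.reg y → vc B q s fun t s' => Q (1 + t) s')
  | .whileLt x y p, s, Q => Terminates B (.whileLt x y p) s Q

theorem vc.mono {B : ℕ} {p : Program} {s : State} {Q Q' : ℕ → State → Prop}
    (h : vc B p s Q) (hQ : ∀ t s', Q t s' → Q' t s') : vc B p s Q' := by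
  induction p generalizing s Q Q' with
  | skip | copy | sub | load | store => exact hQ _ _ h
  | const | add => exact ⟨h.1, hQ _ _ h.2⟩
  | seq p q ihp ihq => exact ihp h fun _ _ h' => ihq h' fun _ _ h'' => hQ _ _ h''
  | ifLt x y p q ihp ihq =>
    exact ⟨fun hlt => ihp (h.1 hlt) fun _ _ h' => hQ _ _ h',
      fun hlt => ihq (h.2 hlt) fun _ _ h' => hQ _ _ h'⟩
  | whileLt => exact Terminates.mono h hQ

/-- The invariant `Bounded` inside `Terminates` guarantees the word bound of every instruction that
only moves or decreases numbers, so `vc` has to ask for it only at `const` and `add`. -/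
theorem terminates_of_vc {B : ℕ} {p : Program} {s : State} {Q : ℕ → State → Prop}
    (h : vc B p s Q) : Terminates B p s Q := by
  induction p generalizing s Q with
  | skip => exact fun hs => ⟨_, _, .skip s, hs, h⟩
  | const x k => exact fun hs => ⟨_, _, .const s x k h.1, hs.setReg x h.1, h.2⟩
  | copy x y => exact fun hs => ⟨_, _, .copy s x y (hs.1 y), hs.setReg x (hs.1 y), h⟩
  | add x y z => exact fun hs => ⟨_, _, .add s x y z h.1, hs.setReg x h.1, h.2⟩
  | sub x y z =>
    exact fun hs => have hb := (Nat.sub_le _ _).trans (hs.1 y)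
      ⟨_, _, .sub s x y z hb, hs.setReg x hb, h⟩
  | load x a y =>
    exact fun hs => ⟨_, _, .load s x a y (hs.2 _ _), hs.setReg x (hs.2 _ _), h⟩
  | store a x y => exact fun hs => ⟨_, _, .store s a x y (hs.1 y), hs.setArr a _ (hs.1 y), h⟩
  | seq p q ihp ihq => exact .seq ((ihp h).mono fun _ _ h' => ihq h')
  | ifLt x y p q ihp ihq =>
    intro hs
    by_cases hlt : s.reg x < s.reg y
    · obtain ⟨t, s', he, hb, hq⟩ := ihp (h.1 hlt) hs
      exact ⟨_, _, .ifLt_pos hlt he, hb, hq⟩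
    · obtain ⟨t, s', he, hb, hq⟩ := ihq (h.2 hlt) hs
      exact ⟨_, _, .ifLt_neg hlt he, hb, hq⟩
  | whileLt x y p _ => exact h

@[simp] theorem State.reg_setReg (s : State) (x k y : ℕ) :
    (s.setReg x k).reg y = if y = x then k else s.reg y := by
  simp [State.setReg, Function.update_apply]

@[simp] theorem State.arr_setReg (s : State) (x k : ℕ) : (s.setReg x k).arr = s.arr := rfl

@[simp] theorem State.reg_setArr (s : State) (a i k : ℕ) : (s.setArr a i k).reg = s.reg := rfl

@[simp] theorem State.arr_setArr (s : State) (a i k b : ℕ) :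
    (s.setArr a i k).arr b = if b = a then Function.update (s.arr a) i k else s.arr b := by
  by_cases h : b = a
  · subst h; simp [State.setArr]
  · simp [State.setArr, h]

/-- The program that runs the programs of a list one after the other. -/
def block : List Program → Program
  | [] => .skip
  | [p] => p
  | p :: q :: l => .seq p (block (q :: l))

/-! ### Orderings of lexicographic breadth-first search -/

/-- The ordering `0, 1, …` of the vertices satisfies, up to the vertex `k`, the characteristic
property of orderings of lexicographic breadth-first search. -/
def IsLexBFSOrdering (A : ℕ → ℕ → Prop) (k : ℕ) : Prop :=
  ∀ a b c, a < b → b < c → c ≤ k → A a c → ¬ A a b → ∃ d < a, A d b ∧ ¬ A d c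

/-- No vertex before `t` distinguishes the vertices from `t` to `k`. -/
def IsUniform (A : ℕ → ℕ → Prop) (k t : ℕ) : Prop :=
  ∀ u, t ≤ u → u ≤ k → ∀ d < t, (A d u ↔ A d k)

/-- A vertex seen by `k` but not by `t` would, by the ordering property, require an earlier one seen
by `t` but not by `k`, which `h` excludes. So `t` and `k` have the same neighbours before `t`, and
the vertices between them are squeezed lexicographically. -/
theorem IsLexBFSOrdering.isUniform {A : ℕ → ℕ → Prop} {k t : ℕ} (hA : IsLexBFSOrdering A k)
    (ht : t < k) (h : ∀ d < t, A d t → A d k) : IsUniform A k t := by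
  have h' : ∀ d < t, (A d t ↔ A d k) := by
    intro d hd
    refine ⟨h d hd, fun hk => ?_⟩
    by_contra hn
    obtain ⟨e, he, h1, h2⟩ := hA d t k hd ht le_rfl hk hn
    exact h2 (h e (he.trans hd) h1)
  intro u htu huk d
  induction d using Nat.strong_induction_on with
  | _ d ih =>
    intro hd
    rcases htu.eq_or_lt with rfl | htu
    · exact h' d hd
    rcases huk.eq_or_lt with rfl | huk
    · rfl
    constructor
    · intro hu
      by_contra hk
      obtain ⟨e, he, h1, h2⟩ := hA d t u hd htu huk.le hu (fun h1 => hk ((h' d hd).1 h1))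
      exact h2 ((ih e he (he.trans hd)).2 ((h' e (he.trans hd)).1 h1))
    · intro hk
      by_contra hu
      obtain ⟨e, he, h1, h2⟩ := hA d u k (hd.trans htu) huk le_rfl hk hu
      exact h2 ((ih e he (he.trans hd)).1 h1)

/-- The new `t'` is the first `R`-vertex from `t` on. Its neighbours before `t` are neighbours of
`k` by uniformity; those from `t` on are not in `R` by minimality and not in `L` by `hLR`, so they
are neighbours of `k` by `hC`. -/
theorem IsLexBFSOrdering.exists_next_isUniform {A : ℕ → ℕ → Prop} {k t y : ℕ} {L R : ℕ → Prop}
    (hA : IsLexBFSOrdering A k) (hLR : ∀ i j, L i → R j → ¬ A i j)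
    (hC : ∀ c < k, ¬ L c → ¬ R c → A c k) (hyk : y < k) (hy : R y)
    (ht : IsUniform A k t) (hty : t ≤ y)
    (hfirst : ∀ j, t ≤ j → j ≤ y → R j → ∃ i, t ≤ i ∧ i < j ∧ L i) :
    ∃ t', t < t' ∧ IsUniform A k t' ∧ t' ≤ y ∧ R t' := by
  classical
  have hex : ∃ j, t ≤ j ∧ R j := ⟨y, hty, hy⟩
  obtain ⟨h1, h2⟩ := Nat.find_spec hex
  have h3 : Nat.find hex ≤ y := Nat.find_min' hex ⟨hty, hy⟩
  obtain ⟨i, hi, hi', -⟩ := hfirst _ h1 h3 h2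
  refine ⟨Nat.find hex, by omega, hA.isUniform (by omega) fun d hd hAd => ?_, h3, h2⟩
  by_cases hdt : d < t
  · exact (ht _ h1 (by omega) d hdt).1 hAd
  · exact hC d (by omega) (fun hL => hLR _ _ hL h2 hAd)
      fun hR => Nat.find_min hex hd ⟨by omega, hR⟩

/-- A last vertex of lexicographic breadth-first search does not separate. -/
theorem IsLexBFSOrdering.not_separated {A : ℕ → ℕ → Prop} {k x y : ℕ} {L R : ℕ → Prop}
    (hA : IsLexBFSOrdering A k) (hLR : ∀ i j, L i → R j → ¬ A i j)
    (hdis : ∀ i, L i → ¬ R i) (hRL : ∀ i j, L i → R j → ¬ A j i)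
    (hC : ∀ c < k, ¬ L c → ¬ R c → A c k) (hxk : x < k) (hyk : y < k) (hx : L x) (hy : R y)
    (hX : ∀ t, IsUniform A k t → t ≤ y → R t → t ≤ x)
    (hY : ∀ t, IsUniform A k t → t ≤ x → L t → t ≤ y) : False := by
  -- Whichever of `L` and `R` occurs first from `t` on, jumping to the first vertex of the other
  -- kind gives a later uniform position, and `hX` or `hY` keeps it before both `x` and `y`. This
  -- cannot go on forever; it starts at `t = 0`, which is vacuously uniform.
  have key : ∀ m t, x - t = m → IsUniform A k t → t ≤ x → t ≤ y → False := by
    intro m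
    induction m using Nat.strong_induction_on with
    | _ m ih =>
      intro t hm ht htx hty
      by_cases hfirst : ∀ j, t ≤ j → j ≤ y → R j → ∃ i, t ≤ i ∧ i < j ∧ L i
      · obtain ⟨t', h1, h2, h3, h4⟩ :=
          hA.exists_next_isUniform hLR hC hyk hy ht hty hfirst
        have := hX t' h2 h3 h4
        exact ih (x - t') (by omega) t' rfl h2 this h3
      · push Not at hfirst
        obtain ⟨j, hj, -, hRj, hno⟩ := hfirst
        have hfirst' : ∀ i, t ≤ i → i ≤ x → L i → ∃ j, t ≤ j ∧ j < i ∧ R j := by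
          intro i hi _ hLi
          refine ⟨j, hj, ?_, hRj⟩
          by_contra hlt
          rcases (not_lt.1 hlt).eq_or_lt with rfl | hlt
          · exact hdis _ hLi hRj
          · exact hno i hi hlt hLi
        obtain ⟨t', h1, h2, h3, h4⟩ :=
          hA.exists_next_isUniform (fun i j hi hj => hRL j i hj hi)
            (fun c hc h1 h2 => hC c hc h2 h1) hxk hx ht htx hfirst'
        have := hY t' h2 h3 h4
        exact ih (x - t') (by omega) t' rfl h2 h3 this
  exact key _ 0 rfl (fun _ _ _ d hd => absurd hd (Nat.not_lt_zero d)) (Nat.zero_le _) (Nat.zero_le _)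

/-! ### Simple vertices of interval graphs -/

/-- `l` and `r` are the ends of intervals that represent the adjacency relation `A` on the vertices
satisfying `P`. -/
structure IsIntervalModel (A : ℕ → ℕ → Prop) (P : ℕ → Prop) (l r : ℕ → ℝ) : Prop where
  le : ∀ u, P u → l u ≤ r u
  adj_iff : ∀ u v, P u → P v → u ≠ v → (A u v ↔ l u ≤ r v ∧ l v ≤ r u)

/-- Among the vertices satisfying `P`, the closed neighbourhoods of the neighbours of `z` are
nested. -/
def IsSimple (A : ℕ → ℕ → Prop) (P : ℕ → Prop) (z : ℕ) : Prop :=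
  ∀ a b, P a → P b → a ≠ b → A a z → A b z →
    (∀ x, P x → x ≠ b → A x a → A x b) ∨ ∀ x, P x → x ≠ a → A x b → A x a

/-- Here `L` and `R` are the intervals entirely to the left and to the right of `p`. Every other
interval contains `p`, as does that of `k`, and therefore meets it. -/
theorem IsIntervalModel.not_separated {A : ℕ → ℕ → Prop} {k x y : ℕ} {l r : ℕ → ℝ} {p : ℝ}
    (hm : IsIntervalModel A (· ≤ k) l r) (hA : IsLexBFSOrdering A k)
    (hk : l k ≤ p ∧ p ≤ r k) (hxk : x < k) (hyk : y < k) (hx : r x < p) (hy : p < l y)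
    (hX : ∀ t, IsUniform A k t → t ≤ y → ¬ A x t → t ≤ x)
    (hY : ∀ t, IsUniform A k t → t ≤ x → ¬ A y t → t ≤ y) : False := by
  have hLR : ∀ i j, i ≤ k → j ≤ k → r i < p → p < l j → i ≠ j ∧ ¬ A i j ∧ ¬ A j i := by
    intro i j hi hj h1 h2
    have hij : i ≠ j := by
      rintro rfl
      linarith [hm.le i hi]
    refine ⟨hij, fun h => ?_, fun h => ?_⟩
    · linarith [((hm.adj_iff i j hi hj hij).1 h).2]
    · linarith [((hm.adj_iff j i hj hi hij.symm).1 h).1]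
  refine hA.not_separated (L := fun i => i ≤ k ∧ r i < p) (R := fun i => i ≤ k ∧ p < l i)
    (x := x) (y := y) (fun i j hi hj => (hLR i j hi.1 hj.1 hi.2 hj.2).2.1)
    (fun i hi hj => (hLR i i hi.1 hj.1 hi.2 hj.2).1 rfl)
    (fun i j hi hj => (hLR i j hi.1 hj.1 hi.2 hj.2).2.2) ?_ hxk hyk ⟨hxk.le, hx⟩ ⟨hyk.le, hy⟩ ?_ ?_
  · intro c hc h1 h2
    have h1 : p ≤ r c := not_lt.1 fun h => h1 ⟨hc.le, h⟩
    have h2 : l c ≤ p := not_lt.1 fun h => h2 ⟨hc.le, h⟩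
    exact (hm.adj_iff c k hc.le le_rfl hc.ne).2 ⟨by linarith, by linarith⟩
  · exact fun t ht h1 h2 => hX t ht h1 (hLR x t hxk.le h2.1 hx h2.2).2.1
  · exact fun t ht h1 h2 => hY t ht h1 (hLR t y h2.1 hyk.le h2.2 hy).2.2

/-- The last vertex of lexicographic breadth-first search in an interval graph is simple. -/
theorem IsIntervalModel.isSimple_of_isLexBFSOrdering {A : ℕ → ℕ → Prop} {k : ℕ} {l r : ℕ → ℝ}
    (hm : IsIntervalModel A (· ≤ k) l r) (hsymm : ∀ u v, A u v → A v u) (hirr : ∀ u, ¬ A u u)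
    (hA : IsLexBFSOrdering A k) : IsSimple A (· ≤ k) k := by
  -- Disjoint neighbours of `k` would be separated by the midpoint of the gap between them, which
  -- `k` covers. A uniform position after `a` cannot be a non-neighbour of `a`, since `k` is a
  -- neighbour.
  have hclique : ∀ a b, a ≤ k → b ≤ k → a ≠ b → A a k → A b k → r a < l b → False := by
    intro a b ha hb hab hak hbk hlt
    have hak' : a ≠ k := by rintro rfl; exact hirr _ hak
    have hbk' : b ≠ k := by rintro rfl; exact hirr _ hbk
    have h1 := (hm.adj_iff a k ha le_rfl hak').1 hak
    have h2 := (hm.adj_iff b k hb le_rfl hbk').1 hbk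
    refine hm.not_separated (x := a) (y := b) (p := (r a + l b) / 2) hA
      ⟨by linarith, by linarith⟩ (by omega) (by omega) (by linarith) (by linarith) ?_ ?_
    · intro t ht htb hat
      by_contra hcon
      exact hat ((ht t le_rfl (by omega) a (by omega)).2 hak)
    · intro t ht htb hat
      by_contra hcon
      exact hat ((ht t le_rfl (by omega) b (by omega)).2 hbk)
  -- Since `a`, `b`, `k` meet pairwise, `y` must lie to the right of `a`, and `max (l b) (l k)` is a
  -- point of `k` between `x` and `y`. A uniform position up to `a` cannot distinguish `a` from `k`
  -- for `x`; one after `a` cannot distinguish `y` from `k` for `a`.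
  have hbull : ∀ a b x y, a ≤ k → b ≤ k → x ≤ k → y ≤ k → a ≠ b → A a k → A b k → A x a →
      ¬ A x b → A y b → ¬ A y a → x ≠ b → y ≠ a → r x < l b → False := by
    intro a b x y ha hb hx hy hab hak hbk hxa hxb hyb hya hxb' hya' hlt
    have hak' : a ≠ k := by rintro rfl; exact hirr _ hak
    have hbk' : b ≠ k := by rintro rfl; exact hirr _ hbk
    have hxa' : x ≠ a := by rintro rfl; exact hirr _ hxa
    have hyb' : y ≠ b := by rintro rfl; exact hirr _ hyb
    have hxk : x ≠ k := by rintro rfl; exact hxb (hsymm _ _ hbk)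
    have hyk : y ≠ k := by rintro rfl; exact hya (hsymm _ _ hak)
    have h1 := (hm.adj_iff a k ha le_rfl hak').1 hak
    have h2 := (hm.adj_iff b k hb le_rfl hbk').1 hbk
    have h3 : l a ≤ r b := not_lt.1 (hclique b a hb ha hab.symm hbk hak)
    have h4 : l b ≤ r a := not_lt.1 (hclique a b ha hb hab hak hbk)
    have h5 := (hm.adj_iff x a hx ha hxa').1 hxa
    have h6 := (hm.adj_iff y b hy hb hyb').1 hyb
    have h7 : r a < l y := by
      by_contra hcon
      exact hya ((hm.adj_iff y a hy ha hya').2 ⟨by linarith, by linarith⟩)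
    have hka := hm.le a ha
    have hkk := hm.le k le_rfl
    refine hm.not_separated (x := x) (y := y) (p := max (l b) (l k)) hA ⟨le_max_right _ _, ?_⟩
      (by omega) (by omega) (lt_max_of_lt_left hlt) ?_ ?_ ?_
    · exact max_le (by linarith) hkk
    · exact max_lt (by linarith) (by linarith)
    · intro t ht hty hxt
      by_contra hcon
      by_cases hta : t ≤ a
      · have e1 := ht t le_rfl (by omega) x (by omega)
        have e2 := ht a hta ha x (by omega)
        exact hxt (e1.2 (e2.1 hxa))
      · exact hya (hsymm _ _ ((ht y hty hy a (by omega)).2 hak))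
    · intro t ht hty hyt
      by_contra hcon
      by_cases htb : t ≤ b
      · have e1 := ht t le_rfl (by omega) y (by omega)
        have e2 := ht b htb hb y (by omega)
        exact hyt (e1.2 (e2.1 hyb))
      · exact hxb (hsymm _ _ ((ht x hty hx b (by omega)).2 hbk))
  intro a b ha hb hab hak hbk
  by_contra hcon
  push Not at hcon
  obtain ⟨⟨x, hx, hxb, hxa, hnxb⟩, y, hy, hya, hyb, hnya⟩ := hcon
  by_cases hlt : r x < l b
  · exact hbull a b x y ha hb hx hy hab hak hbk hxa hnxb hyb hnya hxb hya hlt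
  · refine hbull b a y x hb ha hy hx hab.symm hbk hak hyb hnya hxa hnxb hya hxb ?_
    by_contra hlt'
    have hxa' : x ≠ a := by rintro rfl; exact hirr _ hxa
    have hyb' : y ≠ b := by rintro rfl; exact hirr _ hyb
    have h5 := (hm.adj_iff x a hx ha hxa').1 hxa
    have h6 := (hm.adj_iff y b hy hb hyb').1 hyb
    by_cases h : l x ≤ r b
    · exact hnxb ((hm.adj_iff x b hx hb hxb).2 ⟨h, not_lt.1 hlt⟩)
    by_cases h' : l y ≤ r a
    · exact hnya ((hm.adj_iff y a hy ha hya).2 ⟨h', not_lt.1 hlt'⟩)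
    push Not at h h'
    -- The remaining order is contradictory: `r b < l x ≤ r a < l y ≤ r b`.
    linarith

/-- A vertex whose interval ends first is simple. -/
theorem IsIntervalModel.isSimple_of_forall_le {A : ℕ → ℕ → Prop} {P : ℕ → Prop} {z : ℕ}
    {l r : ℕ → ℝ} (hm : IsIntervalModel A P l r) (hirr : ∀ u, ¬ A u u) (hz : P z)
    (hle : ∀ u, P u → r z ≤ r u) : IsSimple A P z := by
  -- An `x` meeting `a` starts no later than `r a ≤ r b`, and ends no earlier than `r z ≥ l b`; so
  -- it meets `b`.
  have key : ∀ a b, P a → P b → A b z → r a ≤ r b → ∀ x, P x → x ≠ b → A x a → A x b := by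
    intro a b ha hb hbz hab x hx hxb hxa
    have hxa' : x ≠ a := by rintro rfl; exact hirr _ hxa
    have hbz' : b ≠ z := by rintro rfl; exact hirr _ hbz
    have h1 := (hm.adj_iff x a hx ha hxa').1 hxa
    have h2 := (hm.adj_iff b z hb hz hbz').1 hbz
    exact (hm.adj_iff x b hx hb hxb).2 ⟨by linarith, by linarith [hle x hx]⟩
  intro a b ha hb _ haz hbz
  rcases le_total (r a) (r b) with h | h
  · exact .inl (key a b ha hb hbz h)
  · exact .inr (key b a hb ha haz h)

/-! ### Perfect matchings as arrays of partners -/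

/-- `f` maps each vertex below `n` to its partner in a perfect matching. -/
def IsMate (H : SimpleGraph ℕ) (n : ℕ) (f : ℕ → ℕ) : Prop :=
  ∀ u < n, H.Adj u (f u) ∧ f (f u) = u

/-- Replace the pairs `a b` and `c d` by `a d` and `b c`. -/
def flipMate (f : ℕ → ℕ) (a b c d : ℕ) : ℕ → ℕ :=
  Function.update (Function.update (Function.update (Function.update f a d) d a) b c) c b

theorem IsMate.flip {H : SimpleGraph ℕ} {n : ℕ} (hH : ∀ u v, H.Adj u v → u < n) {f : ℕ → ℕ}
    (hf : IsMate H n f) {a b c d : ℕ} (ha : a < n) (hc : c < n) (hab : f a = b) (hcd : f c = d)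
    (hbc : H.Adj b c) (hda : H.Adj d a) (hac : a ≠ c) :
    IsMate H n (flipMate f a b c d) ∧ [a, b, c, d].Nodup := by
  have h1 := (hf a ha)
  have h2 := (hf c hc)
  rw [hab] at h1
  rw [hcd] at h2
  have hb := hH _ _ h1.1.symm
  have hd := hH _ _ h2.1.symm
  have nab := h1.1.ne
  have ncd := h2.1.ne
  have nbc := hbc.ne
  have nda := hda.ne
  have nbd : b ≠ d := by
    rintro rfl
    exact hac (h1.2.symm.trans h2.2)
  refine ⟨fun u hu => ?_, by simp; grind⟩
  have h3 := hf u hu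
  have h4 := hf (f u) (hH _ _ h3.1.symm)
  simp only [flipMate, Function.update_apply]
  have := hbc.symm
  have := hda.symm
  grind

/-- Both partners of `z`, and their partners in the respective other matching, are again vertices of
disagreement, so nestedness in `P` applies to them. The vertex with the smaller neighbourhood hands
its partner over to the other one. -/
theorem IsMate.exists_flip {H : SimpleGraph ℕ} {n : ℕ} (hH : ∀ u v, H.Adj u v → u < n)
    {f g : ℕ → ℕ} (hf : IsMate H n f) (hg : IsMate H n g) {P : ℕ → Prop} {z : ℕ} (hz : z < n)
    (hP : IsSimple H.Adj P z) (hfg : ∀ u < n, f u ≠ g u → P u) (hne : f z ≠ g z) :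
    H.Adj (f z) (f (g z)) ∨ H.Adj (g z) (g (f z)) := by
  have h1 := hf z hz
  have h2 := hg z hz
  have h1' := hH _ _ h1.1.symm
  have h2' := hH _ _ h2.1.symm
  have h3 := hf _ h2'
  have h4 := hg _ h1'
  have h3' := hH _ _ h3.1.symm
  have h4' := hH _ _ h4.1.symm
  have h5 := hf _ h4'
  have h6 := hg _ h3'
  have := h1.1.ne
  have := h2.1.ne
  have := h3.1.ne
  have := h4.1.ne
  rcases hP (f z) (g z) (hfg _ h1' (by grind)) (hfg _ h2' (by grind)) hne h1.1.symm h2.1.symm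
    with h | h
  · exact .inr (h _ (hfg _ h4' (by grind)) (by grind) h4.1.symm).symm
  · exact .inl (h _ (hfg _ h3' (by grind)) (by grind) h3.1.symm).symm

/-- After the flip, `f` and `g` agree at `z` and `g z`, and wherever they agreed before. -/
theorem IsMate.flip_agree {H : SimpleGraph ℕ} {n : ℕ} (hH : ∀ u v, H.Adj u v → u < n)
    {f g : ℕ → ℕ} (hf : IsMate H n f) (hg : IsMate H n g) {z : ℕ} (hz : z < n)
    (hne : f z ≠ g z) {u : ℕ} (hu : u < n)
    (h : flipMate f z (f z) (f (g z)) (g z) u ≠ g u) : f u ≠ g u ∧ u ≠ z ∧ u ≠ g z := by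
  have h1 := hf z hz
  have h2 := hg z hz
  have h1' := hH _ _ h1.1.symm
  have h2' := hH _ _ h2.1.symm
  have h3 := hf _ h2'
  have h4 := hg _ h1'
  have h3' := hH _ _ h3.1.symm
  have h6 := hg _ h3'
  have h7 := hg _ hu
  have h8 := hf _ hu
  have := h1.1.ne
  have := h2.1.ne
  have := h3.1.ne
  simp only [flipMate, Function.update_apply] at h
  grind

/-! ### Partner arrays as subgraphs, and lists of flips -/

section
variable {V : Type*} {G : SimpleGraph V} (φ : V ↪ ℕ)

/-- The matching of the pairs of an array of partners. -/
def mateSubgraph (G : SimpleGraph V) (f : ℕ → ℕ) : G.Subgraph where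
  verts := Set.univ
  Adj u v := G.Adj u v ∧ f (φ u) = φ v ∧ f (φ v) = φ u
  adj_sub h := h.1
  edge_vert _ := Set.mem_univ _
  symm := ⟨fun _ _ h => ⟨h.1.symm, h.2.2, h.2.1⟩⟩

variable {φ} {n : ℕ}

/-- The hypothesis `hφ` says that `φ` numbers the vertices by `0, …, n - 1`. The same lemmas thus
serve an arbitrary finite vertex type and the machine's input on `Fin n`. -/
theorem adj_lt (hφ : ∀ i, i < n ↔ ∃ v, φ v = i) (u v : ℕ) (h : (G.map φ).Adj u v) : u < n := by
  obtain ⟨a, b, -, rfl, rfl⟩ := (SimpleGraph.map_adj ..).1 h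
  exact (hφ _).2 ⟨a, rfl⟩

theorem IsMate.exists_mateSubgraph_adj (hφ : ∀ i, i < n ↔ ∃ v, φ v = i) {f : ℕ → ℕ}
    (hf : IsMate (G.map φ) n f) (v : V) : ∃ w, φ w = f (φ v) ∧ (mateSubgraph φ G f).Adj v w := by
  obtain ⟨h1, h2⟩ := hf (φ v) ((hφ _).2 ⟨v, rfl⟩)
  obtain ⟨a, b, hab, ha, hb⟩ := (SimpleGraph.map_adj ..).1 h1
  obtain rfl := φ.injective ha
  exact ⟨b, hb, hab, hb.symm, by rw [hb, h2]⟩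

theorem IsMate.isPerfectMatching (hφ : ∀ i, i < n ↔ ∃ v, φ v = i) {f : ℕ → ℕ}
    (hf : IsMate (G.map φ) n f) : (mateSubgraph φ G f).IsPerfectMatching := by
  rw [SimpleGraph.Subgraph.isPerfectMatching_iff]
  intro v
  obtain ⟨w, hw, h⟩ := hf.exists_mateSubgraph_adj hφ v
  refine ⟨w, h, fun w' h' => φ.injective ?_⟩
  rw [hw]
  exact h'.2.1.symm

theorem eq_mateSubgraph {M : G.Subgraph} (hM : M.IsPerfectMatching) {f : ℕ → ℕ}
    (hf : ∀ v w, M.Adj v w → f (φ v) = φ w) : M = mateSubgraph φ G f := by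
  ext v w
  · simp [mateSubgraph, hM.2 v]
  · refine ⟨fun h => ⟨h.adj_sub, hf _ _ h, hf _ _ h.symm⟩, fun h => ?_⟩
    obtain ⟨w', hw', -⟩ := hM.1 (hM.2 v)
    have := (hf _ _ hw').symm.trans h.2.1
    rwa [φ.injective this] at hw'

theorem isMate_of_isPerfectMatching (hφ : ∀ i, i < n ↔ ∃ v, φ v = i) {M : G.Subgraph}
    (hM : M.IsPerfectMatching) {f : ℕ → ℕ} (hf : ∀ v w, M.Adj v w → f (φ v) = φ w) :
    IsMate (G.map φ) n f := by
  intro u hu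
  obtain ⟨v, rfl⟩ := (hφ u).1 hu
  obtain ⟨w, hw, -⟩ := hM.1 (hM.2 v)
  rw [hf _ _ hw, hf _ _ hw.symm]
  exact ⟨(SimpleGraph.map_adj ..).2 ⟨v, w, hw.adj_sub, rfl, rfl⟩, rfl⟩

theorem mateSubgraph_congr (hφ : ∀ i, i < n ↔ ∃ v, φ v = i) {f g : ℕ → ℕ}
    (h : ∀ u < n, f u = g u) : mateSubgraph φ G f = mateSubgraph φ G g := by
  have h' : ∀ v, f (φ v) = g (φ v) := fun v => h _ ((hφ _).2 ⟨v, rfl⟩)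
  ext v w
  · rfl
  · simp [mateSubgraph, h']

/-- `M` and `N` differ by the flip along the `4`-cycle `x`. -/
def IsFlipAlong (φ : V ↪ ℕ) (x : ℕ × ℕ × ℕ × ℕ) (M N : G.Subgraph) : Prop :=
  ∃ a b c d : V, x = (φ a, φ b, φ c, φ d) ∧ IsFlip M N a b c d

theorem IsFlipAlong.symm {x : ℕ × ℕ × ℕ × ℕ} {M N : G.Subgraph} (h : IsFlipAlong φ x M N) :
    IsFlipAlong φ x N M := by
  obtain ⟨a, b, c, d, hx, h1, h2⟩ := h
  exact ⟨a, b, c, d, hx, h1, by rw [symmDiff_comm, h2]⟩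

theorem IsMate.isFlipAlong (hφ : ∀ i, i < n ↔ ∃ v, φ v = i) {f : ℕ → ℕ}
    (hf : IsMate (G.map φ) n f) {a b c d : ℕ} (ha : a < n) (hc : c < n) (hab : f a = b)
    (hcd : f c = d) (hbc : (G.map φ).Adj b c) (hda : (G.map φ).Adj d a) (hac : a ≠ c) :
    IsFlipAlong φ (a, b, c, d) (mateSubgraph φ G f) (mateSubgraph φ G (flipMate f a b c d)) := by
  have hnd := (hf.flip (adj_lt hφ) ha hc hab hcd hbc hda hac).2
  have h1 := hf a ha
  have h2 := hf c hc
  rw [hab] at h1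
  rw [hcd] at h2
  obtain ⟨a', b', hab', rfl, rfl⟩ := (SimpleGraph.map_adj ..).1 h1.1
  obtain ⟨c', d', hcd', rfl, rfl⟩ := (SimpleGraph.map_adj ..).1 h2.1
  have hbc' : G.Adj b' c' := by
    obtain ⟨u, v, h, hu, hv⟩ := (SimpleGraph.map_adj ..).1 hbc
    rwa [φ.injective hu, φ.injective hv] at h
  have hda' : G.Adj d' a' := by
    obtain ⟨u, v, h, hu, hv⟩ := (SimpleGraph.map_adj ..).1 hda
    rwa [φ.injective hu, φ.injective hv] at h
  refine ⟨a', b', c', d', rfl, ?_, ?_⟩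
  · have : ([a', b', c', d'].map φ).Nodup := hnd
    exact (List.nodup_map_iff φ.injective).1 this
  · ext e
    induction e with
    | _ u v =>
    have hu := hf (φ u) ((hφ _).2 ⟨u, rfl⟩)
    have hv := hf (φ v) ((hφ _).2 ⟨v, rfl⟩)
    simp only [Set.mem_symmDiff, SimpleGraph.Subgraph.mem_edgeSet, mateSubgraph, flipMate,
      Function.update_apply, Set.mem_insert_iff, Set.mem_singleton_iff, Sym2.eq_iff,
      ← φ.injective.eq_iff]
    simp only [List.nodup_cons, List.mem_cons, List.not_mem_nil, not_or] at hnd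
    have e1 := hab'.symm
    have e2 := hbc'.symm
    have e3 := hcd'.symm
    have e4 := hda'.symm
    have hiff : ∀ x y, φ x = φ y ↔ x = y := fun x y => φ.injective.eq_iff
    have hG : ∀ x y, φ u = φ x → φ v = φ y → G.Adj x y → G.Adj u v := by
      intro x y h h'
      rw [φ.injective h, φ.injective h']
      exact id
    have k1 := hG a' b'
    have k2 := hG b' a'
    have k3 := hG b' c'
    have k4 := hG c' b'
    have k5 := hG c' d'
    have k6 := hG d' c'
    have k7 := hG d' a'
    have k8 := hG a' d'
    have hab'' := hab'.symm
    have hcd'' := hcd'.symm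
    replace hu := hu.2
    replace hv := hv.2
    replace h1 := h1.2
    replace h2 := h2.2
    clear hG hiff hφ hf hbc hda ha hc
    -- What remains is a finite check over which corner of the 4-cycle, if any, is `u'`.
    generalize φ u = u' at *
    generalize φ v = v' at *
    generalize φ a' = a at *
    generalize φ b' = b at *
    generalize φ c' = c at *
    generalize φ d' = d at *
    generalize G.Adj u v = p at *
    by_cases hua : u' = a
    · grind
    by_cases hub : u' = b
    · grind
    by_cases huc : u' = c
    · grind
    by_cases hud : u' = d
    · grind
    grind

/-- The flips of the list `l` lead from `M` to `N`. -/
def IsFlipList (φ : V ↪ ℕ) : List (ℕ × ℕ × ℕ × ℕ) → G.Subgraph → G.Subgraph → Prop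
  | [], M, N => M = N
  | x :: l, M, N => ∃ M' : G.Subgraph,
      M'.IsPerfectMatching ∧ IsFlipAlong φ x M M' ∧ IsFlipList φ l M' N

theorem IsFlipList.append {l l' : List (ℕ × ℕ × ℕ × ℕ)} {M N K : G.Subgraph}
    (h : IsFlipList φ l M N) (h' : IsFlipList φ l' N K) : IsFlipList φ (l ++ l') M K := by
  induction l generalizing M with
  | nil => obtain rfl : M = N := h; exact h'
  | cons x l ih =>
    obtain ⟨M', h1, h2, h3⟩ := h
    exact ⟨M', h1, h2, ih h3⟩

/-- A flip list records perfectness of every matching except the first, which becomes an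
intermediate or final one on reversal; hence `hM`. -/
theorem IsFlipList.reverse {l : List (ℕ × ℕ × ℕ × ℕ)} {M N : G.Subgraph}
    (hM : M.IsPerfectMatching) (h : IsFlipList φ l M N) : IsFlipList φ l.reverse N M := by
  induction l generalizing M with
  | nil => exact Eq.symm h
  | cons x l ih =>
    obtain ⟨M', h1, h2, h3⟩ := h
    rw [List.reverse_cons]
    exact (ih h1 h3).append ⟨M, hM, h2.symm, rfl⟩

theorem IsFlipList.exists_isReconfigurationSequence {l : List (ℕ × ℕ × ℕ × ℕ)} {M N : G.Subgraph}
    (hM : M.IsPerfectMatching) (h : IsFlipList φ l M N) :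
    ∃ S : Fin (l.length + 1) → G.Subgraph, IsReconfigurationSequence M N l.length S ∧
      ∀ i : Fin l.length, IsFlipAlong φ l[i] (S i.castSucc) (S i.succ) := by
  induction l generalizing M with
  | nil =>
    obtain rfl : M = N := h
    exact ⟨fun _ => M, ⟨rfl, rfl, fun _ => hM, fun i => i.elim0⟩, fun i => i.elim0⟩
  | cons x l ih =>
    obtain ⟨M', h1, h2, h3⟩ := h
    obtain ⟨S, hS, hflip⟩ := ih h1 h3
    have hflip' : ∀ i : Fin (l.length + 1), IsFlipAlong φ (x :: l)[i]
        ((Fin.cons M S : Fin (l.length + 1 + 1) → G.Subgraph) i.castSucc)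
        ((Fin.cons M S : Fin (l.length + 1 + 1) → G.Subgraph) i.succ) := by
      intro i
      refine Fin.cases ?_ (fun j => ?_) i
      · simpa [hS.first] using h2
      · simpa [Fin.castSucc_succ] using hflip j
    refine ⟨Fin.cons M S, ⟨rfl, ?_, ?_, ?_⟩, hflip'⟩
    · exact hS.last
    · exact fun i => Fin.cases hM hS.perfect i
    · intro i
      obtain ⟨a, b, c, d, -, hf⟩ := hflip' i
      exact ⟨a, b, c, d, hf⟩

/-! ### Existence of a short sequence of flips -/

theorem IsIntervalGraph.exists_isIntervalModel (hG : IsIntervalGraph G)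
    (hφ : ∀ i, i < n ↔ ∃ v, φ v = i) :
    ∃ l r : ℕ → ℝ, IsIntervalModel (G.map φ).Adj (· < n) l r := by
  -- `Function.invFun` below needs a default vertex.
  rcases isEmpty_or_nonempty V with hV | hV
  · exact ⟨0, 0, fun u hu => ((hφ u).1 hu).elim fun v => hV.elim v,
      fun u v hu => ((hφ u).1 hu).elim fun v => hV.elim v⟩
  obtain ⟨l, r, hle, hadj⟩ := hG
  refine ⟨fun i => l (Function.invFun φ i), fun i => r (Function.invFun φ i),
    fun u _ => hle _, fun u v hu hv huv => ?_⟩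
  obtain ⟨u, rfl⟩ := (hφ u).1 hu
  obtain ⟨v, rfl⟩ := (hφ v).1 hv
  have huv' : u ≠ v := fun h => huv (h ▸ rfl)
  simp only [Function.leftInverse_invFun φ.injective _]
  rw [SimpleGraph.map_adj_apply, hadj u v huv', Set.Icc_inter_Icc, Set.nonempty_Icc]
  simp [hle]
  tauto

/-- Induction on the number of disagreements, which every flip decreases. `key` treats a flip of the
first matching; exchanging the matchings and reversing the list covers the second. -/
theorem IsMate.exists_isFlipList (hφ : ∀ i, i < n ↔ ∃ v, φ v = i) {l r : ℕ → ℝ}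
    (hm : IsIntervalModel (G.map φ).Adj (· < n) l r) {f g : ℕ → ℕ}
    (hf : IsMate (G.map φ) n f) (hg : IsMate (G.map φ) n g) :
    ∃ L, IsFlipList φ L (mateSubgraph φ G f) (mateSubgraph φ G g) ∧
      L.length ≤ ((Finset.range n).filter fun u => f u ≠ g u).card := by
  generalize hD : ((Finset.range n).filter fun u => f u ≠ g u).card = D
  induction D using Nat.strong_induction_on generalizing f g with
  | _ D ih =>
  have hH := adj_lt (G := G) hφ
  have key : ∀ {f g : ℕ → ℕ}, IsMate (G.map φ) n f → IsMate (G.map φ) n g →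
      ((Finset.range n).filter fun u => f u ≠ g u).card = D → ∀ z < n, f z ≠ g z →
      (G.map φ).Adj (f z) (f (g z)) →
      ∃ L, IsFlipList φ L (mateSubgraph φ G f) (mateSubgraph φ G g) ∧ L.length ≤ D := by
    intro f g hf hg hD z hz hne hadj
    have hfz := hf z hz
    have hgz := hg z hz
    have hfgz := hf _ (hH _ _ hgz.1.symm)
    have hzfg : z ≠ f (g z) := by grind
    have hflip := (hf.flip hH hz (hH _ _ hfgz.1.symm) rfl hfgz.2 hadj hgz.1.symm hzfg).1
    have hlt := Finset.card_lt_card (s := (Finset.range n).filter fun u =>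
      flipMate f z (f z) (f (g z)) (g z) u ≠ g u) (t := (Finset.range n).filter fun u => f u ≠ g u)
      ((Finset.ssubset_iff_of_subset fun u hu => by
        simp only [Finset.mem_filter, Finset.mem_range] at hu ⊢
        exact ⟨hu.1, (hf.flip_agree hH hg hz hne hu.1 hu.2).1⟩).2 ⟨z, by simp [hz, hne],
        fun hu => (hf.flip_agree hH hg hz hne hz (Finset.mem_filter.1 hu).2).2.1 rfl⟩)
    obtain ⟨L, hL, hLl⟩ := ih _ (hD ▸ hlt) hflip hg rfl
    exact ⟨_ :: L, ⟨_, hflip.isPerfectMatching hφ,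
      hf.isFlipAlong hφ hz (hH _ _ hfgz.1.symm) rfl hfgz.2 hadj hgz.1.symm hzfg, hL⟩,
      by simp only [List.length_cons]; omega⟩
  rcases ((Finset.range n).filter fun u => f u ≠ g u).eq_empty_or_nonempty with h | h
  · refine ⟨[], mateSubgraph_congr hφ fun u hu => ?_, by simp⟩
    by_contra hne
    have : u ∈ (Finset.range n).filter fun u => f u ≠ g u := by simp [hu, hne]
    simp [h] at this
  -- Among the vertices of disagreement, `z` is the one whose interval ends first.
  obtain ⟨z, hz, hmin⟩ := Finset.exists_min_image _ r h
  simp only [Finset.mem_filter, Finset.mem_range] at hz hmin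
  have hsimple : IsSimple (G.map φ).Adj (fun u => u < n ∧ f u ≠ g u) z :=
    IsIntervalModel.isSimple_of_forall_le (l := l) (r := r)
      ⟨fun u hu => hm.le u hu.1, fun u v hu hv => hm.adj_iff u v hu.1 hv.1⟩ (fun u => by simp)
      hz hmin
  rcases hf.exists_flip hH hg hz.1 hsimple (fun u h h' => ⟨h, h'⟩) hz.2 with hadj | hadj
  · exact key hf hg hD z hz.1 hz.2 hadj
  · obtain ⟨L, hL, hLl⟩ := key hg hf (by simpa only [ne_comm] using hD) z hz.1 hz.2.symm hadj
    exact ⟨L.reverse, hL.reverse (hg.isPerfectMatching hφ), by simpa using hLl⟩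

end

theorem exists_isReconfigurationSequence {V : Type*} [Fintype V] {G : SimpleGraph V}
    (hG : IsIntervalGraph G) {M N : G.Subgraph} (hM : M.IsPerfectMatching)
    (hN : N.IsPerfectMatching) : ∃ (q : ℕ) (S : Fin (q + 1) → G.Subgraph),
      IsReconfigurationSequence M N q S ∧ q ≤ Fintype.card V := by
  classical
  let φ : V ↪ ℕ := (Fintype.equivFin V).toEmbedding.trans Fin.valEmbedding
  have hφ : ∀ i, i < Fintype.card V ↔ ∃ v, φ v = i := fun i =>
    ⟨fun h => ⟨(Fintype.equivFin V).symm ⟨i, h⟩, by simp [φ]⟩, by rintro ⟨v, rfl⟩; simp [φ]⟩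
  have hmate : ∀ {M : G.Subgraph}, M.IsPerfectMatching →
      ∃ f : ℕ → ℕ, ∀ v w, M.Adj v w → f (φ v) = φ w := by
    intro M hM
    have h : ∀ v, ∃ w, M.Adj v w := fun v => (hM.1 (hM.2 v)).exists
    choose w hw using h
    refine ⟨Function.extend φ (fun v => φ (w v)) 0, fun v v' h => ?_⟩
    rw [φ.injective.extend_apply, hM.1.eq_of_adj_left (hw v) h]
  obtain ⟨f, hf⟩ := hmate hM
  obtain ⟨g, hg⟩ := hmate hN
  obtain ⟨l, r, hm⟩ := hG.exists_isIntervalModel hφ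
  obtain ⟨L, hL, hlen⟩ := (isMate_of_isPerfectMatching hφ hM hf).exists_isFlipList hφ hm
    (isMate_of_isPerfectMatching hφ hN hg)
  rw [← eq_mateSubgraph hM hf, ← eq_mateSubgraph hN hg] at hL
  obtain ⟨S, hS, -⟩ := hL.exists_isReconfigurationSequence hM
  exact ⟨_, S, hS, hlen.trans ((Finset.card_filter_le _ _).trans (by simp))⟩

/-! ### Lexicographic breadth-first search by partition refinement -/

/-- The data of partition refinement: an ordering of the vertices and its inverse; the class of each
vertex; for each class its first position, the last round in which it was split, and the class that
was split off then; the number of classes. -/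
structure Partition where
  ord : ℕ → ℕ
  pos : ℕ → ℕ
  cls : ℕ → ℕ
  head : ℕ → ℕ
  stamp : ℕ → ℕ
  child : ℕ → ℕ
  fresh : ℕ

namespace Partition

/-- Remove the vertex at position `i` from its class. -/
def pivot (P : Partition) (i : ℕ) : Partition :=
  { P with head := Function.update P.head (P.cls (P.ord i)) (i + 1) }

/-- Make sure that there is a class for the vertices to be split off class `c` in round `i`. -/
def touch (P : Partition) (i c : ℕ) : Partition :=
  if P.stamp c < i + 1 then
    { P with
      -- Stamps are shifted by one so that the initial value 0 means "never split".
      stamp := Function.update P.stamp c (i + 1)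
      child := Function.update P.child c P.fresh
      -- The new class starts out empty, at the front of `c`; it will occupy the positions from its
      -- own head up to the advancing head of `c`.
      head := Function.update P.head P.fresh (P.head c)
      fresh := P.fresh + 1 }
  else P

/-- Split `w` off its class. -/
def move (P : Partition) (w : ℕ) : Partition :=
  { P with
    ord := Function.update (Function.update P.ord (P.pos w) (P.ord (P.head (P.cls w))))
      (P.head (P.cls w)) w
    pos := Function.update (Function.update P.pos (P.ord (P.head (P.cls w))) (P.pos w)) w
      (P.head (P.cls w))
    head := Function.update P.head (P.cls w) (P.head (P.cls w) + 1)
    cls := Function.update P.cls w (P.child (P.cls w)) }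

/-- `ord` and `pos` are inverse permutations of the numbers below `n`. -/
structure IsPerm (P : Partition) (n : ℕ) : Prop where
  ord_lt : ∀ p < n, P.ord p < n
  pos_lt : ∀ v < n, P.pos v < n
  pos_ord : ∀ p < n, P.pos (P.ord p) = p
  ord_pos : ∀ v < n, P.ord (P.pos v) = v

/-- The invariant after `i` rounds. -/
structure Inv (A : ℕ → ℕ → Prop) (n i : ℕ) (P : Partition) : Prop extends P.IsPerm n where
  cls_lt : ∀ v < n, i ≤ P.pos v → P.cls v < P.fresh
  stamp_le : ∀ c, P.stamp c ≤ i
  le_head : ∀ v < n, i ≤ P.pos v → i ≤ P.head (P.cls v)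
  -- Classes are contiguous blocks of positions, each starting at its head.
  segment : ∀ p q, i ≤ p → p ≤ q → q < n →
    (P.cls (P.ord p) = P.cls (P.ord q) ↔ P.head (P.cls (P.ord q)) ≤ p)
  same : ∀ x < n, ∀ y < n, i ≤ P.pos x → i ≤ P.pos y → P.cls x = P.cls y →
    ∀ d < i, (A (P.ord d) x ↔ A (P.ord d) y)
  lex : ∀ x < n, ∀ y < n, i ≤ P.pos x → P.pos x < P.pos y → ∀ a < i, A (P.ord a) y →
    ¬ A (P.ord a) x → ∃ d < a, A (P.ord d) x ∧ ¬ A (P.ord d) y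
  -- Needed to preserve `lex`: when the next pivot sees the later of two vertices of different
  -- classes but not the earlier, an older pivot must already justify their order.
  diff : ∀ x < n, ∀ y < n, i ≤ P.pos x → P.pos x < P.pos y → P.cls x ≠ P.cls y →
    ∃ d < i, A (P.ord d) x ∧ ¬ A (P.ord d) y
  done : ∀ a b, a < b → b < i → ∀ y < n, b < P.pos y → A (P.ord a) y →
    ¬ A (P.ord a) (P.ord b) → ∃ d < a, A (P.ord d) (P.ord b) ∧ ¬ A (P.ord d) y

/-- The invariant within round `i`, which started from `P₀`, when the vertices in `S` have been
split off their classes. -/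
structure RoundInv (n i : ℕ) (P₀ : Partition) (S : ℕ → Prop) (P : Partition) : Prop
    extends P.IsPerm n where
  ord_eq : ∀ d ≤ i, P.ord d = P₀.ord d
  fresh_le : P₀.fresh ≤ P.fresh
  cls_lt₀ : ∀ v < n, i < P.pos v → P₀.cls v < P₀.fresh
  cls_of_not_mem : ∀ x < n, i < P.pos x → ¬ S x → P.cls x = P₀.cls x
  of_mem : ∀ x, S x → x < n ∧ i < P.pos x ∧ P.stamp (P₀.cls x) = i + 1 ∧
    P.cls x = P.child (P₀.cls x)
  stamped : ∀ c, P.stamp c = i + 1 → c < P₀.fresh ∧ P₀.fresh ≤ P.child c ∧ P.child c < P.fresh ∧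
    i < P.head (P.child c) ∧ P.head (P.child c) ≤ P.head c
  inj : ∀ c c', P.stamp c = i + 1 → P.stamp c' = i + 1 → P.child c = P.child c' → c = c'
  stamp_le : ∀ c, P.stamp c ≤ i + 1
  lt_head : ∀ x < n, i < P.pos x → i < P.head (P.cls x)
  segment : ∀ p q, i < p → p ≤ q → q < n →
    (P.cls (P.ord p) = P.cls (P.ord q) ↔ P.head (P.cls (P.ord q)) ≤ p)
  child_segment : ∀ c, P.stamp c = i + 1 → ∀ p, i < p → p < n →
    (P.cls (P.ord p) = P.child c ↔ P.head (P.child c) ≤ p ∧ p < P.head c)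
  before : ∀ x < n, ∀ y < n, i < P.pos x → i < P.pos y → P₀.cls x ≠ P₀.cls y →
    P₀.pos x < P₀.pos y → P.pos x < P.pos y
  front : ∀ x < n, ∀ y < n, i < P.pos y → S x → ¬ S y → P₀.cls x = P₀.cls y → P.pos x < P.pos y

/-! ### Preservation of the invariants of partition refinement -/

variable {A : ℕ → ℕ → Prop} {n i : ℕ} {P P₀ : Partition} {S : ℕ → Prop}

/-- Position `i` is the first of its block, so advancing the head removes just the pivot. All stamps
are still at most `i`, which makes the conditions on split classes vacuous. -/
theorem Inv.pivot (h : P.Inv A n i) :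
    RoundInv n i P (fun _ => False) (P.pivot i) where
  ord_lt := h.ord_lt
  pos_lt := h.pos_lt
  pos_ord := h.pos_ord
  ord_pos := h.ord_pos
  ord_eq _ _ := rfl
  fresh_le := le_rfl
  cls_lt₀ v hv hp := h.cls_lt v hv hp.le
  cls_of_not_mem _ _ _ _ := rfl
  of_mem _ h := h.elim
  stamped c hc := by
    have := h.stamp_le c
    simp only [Partition.pivot] at hc
    omega
  inj c _ hc := by
    have := h.stamp_le c
    simp only [Partition.pivot] at hc
    omega
  stamp_le c := (h.stamp_le c).trans (Nat.le_succ i)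
  lt_head x hx hp := by
    have h1 := h.segment i (P.pos x) le_rfl hp.le (h.pos_lt x hx)
    rw [h.ord_pos x hx] at h1
    simp only [Partition.pivot, Function.update_apply] at *
    grind
  segment p q hp hq hn := by
    have h1 := h.segment p q hp.le hq hn
    have h2 := h.segment i q le_rfl (by omega) hn
    simp only [Partition.pivot, Function.update_apply] at *
    grind
  child_segment c hc := by
    have := h.stamp_le c
    simp only [Partition.pivot] at hc
    omega
  before _ _ _ _ _ _ _ h := h
  front _ _ _ _ _ h := h.elim

theorem RoundInv.cls_lt (h : RoundInv n i P₀ S P) {v : ℕ} (hv : v < n) (hp : i < P.pos v) :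
    P.cls v < P.fresh := by
  by_cases hS : S v
  · obtain ⟨-, -, h1, h2⟩ := h.of_mem v hS
    exact h2 ▸ (h.stamped _ h1).2.2.1
  · exact h.cls_of_not_mem v hv hp hS ▸ (h.cls_lt₀ v hv hp).trans_le h.fresh_le

/-- No remaining vertex carries the number `P.fresh`, so the class created is an empty block and
disturbs nothing. -/
theorem RoundInv.touch (h : RoundInv n i P₀ S P) {w : ℕ} (hw : w < n) (hp : i < P.pos w)
    (hS : ¬ S w) : RoundInv n i P₀ S (P.touch i (P.cls w)) ∧
      (P.touch i (P.cls w)).stamp (P.cls w) = i + 1 := by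
  have hle := h.stamp_le (P.cls w)
  by_cases hlt : P.stamp (P.cls w) < i + 1
  swap
  · simp only [Partition.touch, hlt, if_false]
    exact ⟨h, by omega⟩
  simp only [Partition.touch, hlt, if_true]
  have hc : P.cls w < P₀.fresh := h.cls_of_not_mem w hw hp hS ▸ h.cls_lt₀ w hw hp
  have hfr := h.fresh_le
  have hlt' : ∀ v < n, i < P.pos v → P.cls v < P.fresh := fun v => h.cls_lt
  refine ⟨{ h with fresh_le := ?_, of_mem := ?_, stamped := ?_, inj := ?_, stamp_le := ?_,
                   lt_head := ?_, segment := ?_, child_segment := ?_ }, by simp⟩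
  · exact hfr.trans (Nat.le_succ _)
  · intro x hx
    have := h.of_mem x hx
    simp only [Function.update_apply]
    grind
  · intro c hc
    have h1 := h.stamped c
    have h2 := h.lt_head w hw hp
    simp only [Function.update_apply] at *
    grind
  · intro c c' hc hc'
    have h1 := h.stamped c
    have h2 := h.stamped c'
    have h3 := h.inj c c'
    simp only [Function.update_apply] at *
    grind
  · intro c
    have h1 := h.stamp_le c
    simp only [Function.update_apply] at *
    grind
  · intro x hx hxp
    have h1 := h.lt_head x hx hxp
    have h2 := hlt' x hx hxp
    simp only [Function.update_apply] at *
    grind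
  · intro p q hp hpq hq
    have h1 := h.segment p q hp hpq hq
    have h2 := hlt' (P.ord q) (h.ord_lt q hq) (by rw [h.pos_ord q hq]; omega)
    simp only [Function.update_apply] at *
    grind
  · intro c hc p hp hpn
    have h1 := h.child_segment c
    have h2 := hlt' (P.ord p) (h.ord_lt p hpn) (by rw [h.pos_ord p hpn]; omega)
    have h3 := h.stamped c
    simp only [Function.update_apply] at *
    grind

theorem IsPerm.move (h : P.IsPerm n) {w : ℕ} (hw : w < n) (hh : P.head (P.cls w) < n) :
    (P.move w).IsPerm n where
  ord_lt p hp := by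
    have h1 := h.ord_lt p hp
    have h2 := h.ord_lt _ hh
    simp only [Partition.move, Function.update_apply]
    grind
  pos_lt v hv := by
    have h1 := h.pos_lt v hv
    have h2 := h.pos_lt w hw
    simp only [Partition.move, Function.update_apply]
    grind
  pos_ord p hp := by
    have h1 := h.pos_ord p hp
    have h2 := h.pos_ord _ hh
    have h3 := h.ord_pos _ hw
    simp only [Partition.move, Function.update_apply]
    grind
  ord_pos v hv := by
    have h1 := h.ord_pos v hv
    have h2 := h.pos_ord _ hh
    have h3 := h.ord_pos _ hw
    simp only [Partition.move, Function.update_apply]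
    grind

/-- Exchanging `w` with the first vertex of its class and advancing the head shifts the boundary
between the split-off part and the rest by one position; no other block changes. -/
theorem RoundInv.move (h : RoundInv n i P₀ S P) {w : ℕ} (hw : w < n) (hp : i < P.pos w)
    (hS : ¬ S w) (hst : P.stamp (P.cls w) = i + 1) :
    RoundInv n i P₀ (fun x => S x ∨ x = w) (P.move w) := by
  have hpn := h.pos_lt w hw
  have hopw := h.ord_pos w hw
  have hcw := h.cls_of_not_mem w hw hp hS
  obtain ⟨hc0, hck, hkf, hik, hkc⟩ := h.stamped _ hst
  have hih := h.lt_head w hw hp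
  have hhp : P.head (P.cls w) ≤ P.pos w := by
    have := h.segment _ _ hp le_rfl hpn
    rw [hopw] at this
    exact this.1 rfl
  have hseg : ∀ q, i < q → q ≤ P.pos w → (P.cls (P.ord q) = P.cls w ↔ P.head (P.cls w) ≤ q) := by
    intro q h1 h2
    have := h.segment q _ h1 h2 hpn
    rwa [hopw] at this
  have hclsu := (hseg _ hih hhp).2 le_rfl
  have hhn : P.head (P.cls w) < n := by omega
  have hun := h.ord_lt _ hhn
  have hposu := h.pos_ord _ hhn
  have hperm := h.toIsPerm.move hw hhn
  -- From the head of the class up to `w` nothing has been split off: split-off vertices carry class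
  -- numbers at least `P₀.fresh`, and that of `w` is smaller.
  have hnS : ∀ q, P.head (P.cls w) ≤ q → q ≤ P.pos w →
      ¬ S (P.ord q) ∧ P₀.cls (P.ord q) = P.cls w := by
    intro q h1 h2
    have h3 := (hseg q (by omega) h2).2 h1
    have h4 : ¬ S (P.ord q) := by
      intro hSq
      obtain ⟨-, -, h5, h6⟩ := h.of_mem _ hSq
      have := (h.stamped _ h5).2.1
      omega
    have h5 := h.cls_of_not_mem (P.ord q) (h.ord_lt q (by omega))
      (by rw [h.pos_ord q (by omega)]; omega) h4
    exact ⟨h4, by omega⟩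
  have hu := hnS _ le_rfl hhp
  -- the classes along the positions
  have hcls : ∀ q < n, (P.move w).cls ((P.move w).ord q) =
      if q = P.head (P.cls w) then P.child (P.cls w) else P.cls (P.ord q) := by
    intro q hq
    have h1 := h.pos_ord q hq
    simp only [Partition.move, Function.update_apply]
    grind
  have hhead : ∀ c, (P.move w).head c =
      if c = P.cls w then P.head (P.cls w) + 1 else P.head c := fun c => by
    simp only [Partition.move, Function.update_apply]
  have hpos : ∀ v, (P.move w).pos v = if v = w then P.head (P.cls w) else
      if v = P.ord (P.head (P.cls w)) then P.pos w else P.pos v := fun v => by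
    simp only [Partition.move, Function.update_apply]
  have hcls' : ∀ v, (P.move w).cls v = if v = w then P.child (P.cls w) else P.cls v := fun v => by
    simp only [Partition.move, Function.update_apply]
  have hlt : ∀ v, i < (P.move w).pos v → i < P.pos v := by
    intro v hv
    rw [hpos] at hv
    grind
  refine { hperm with
      ord_eq := ?_, fresh_le := h.fresh_le, cls_lt₀ := ?_, cls_of_not_mem := ?_,
      of_mem := ?_, stamped := ?_, inj := h.inj, stamp_le := h.stamp_le, lt_head := ?_,
      segment := ?_, child_segment := ?_, before := ?_, front := ?_ }
  · intro d hd
    rw [← h.ord_eq d hd]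
    simp only [Partition.move, Function.update_apply]
    grind
  · exact fun v hv hv' => h.cls_lt₀ v hv (hlt v hv')
  · intro x hx hxp hxS
    have := h.cls_of_not_mem x hx (hlt x hxp)
    rw [hcls']
    grind
  · intro x hx
    have h1 := h.of_mem x
    rw [hcls', hpos]
    change _ ∧ _ ∧ P.stamp _ = _ ∧ _ = P.child _
    grind
  · intro c hc
    have h1 := h.stamped c hc
    change _ ∧ _ ≤ P.child c ∧ P.child c < P.fresh ∧ _ < (P.move w).head (P.child c) ∧
      (P.move w).head (P.child c) ≤ _
    rw [hhead, hhead]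
    grind
  · intro x hx hxp
    have h1 := h.lt_head x hx (hlt x hxp)
    rw [hcls', hhead]
    grind
  · intro p q hp' hpq hq
    have h1 := h.segment p q hp' hpq hq
    have h2 := h.segment q q (by omega) le_rfl hq
    have h3 := h.child_segment _ hst p hp' (by omega)
    have h4 := h.child_segment _ hst q (by omega) hq
    have h5 := h.segment (P.head (P.cls w)) q hih
    rw [hcls p (by omega), hcls q hq, hhead]
    grind
  · intro c hc p hp' hpn'
    have h1 := h.child_segment c hc p hp' hpn'
    have h2 := h.stamped c hc
    have h3 := h.inj c _ hc hst
    change _ = P.child c ↔ (P.move w).head (P.child c) ≤ _ ∧ _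
    rw [hcls p hpn', hhead, hhead]
    grind
  · intro x hx y hy hxp hyp hne hlt'
    have h1 := h.before x hx y hy (hlt x hxp) (hlt y hyp) hne hlt'
    have h2 := hnS (P.pos x)
    have h3 := hnS (P.pos y)
    rw [h.ord_pos x hx] at h2
    rw [h.ord_pos y hy] at h3
    rw [hpos, hpos]
    grind
  · intro x hx y hy hyp hxS hyS hxy
    push Not at hyS
    have hyp' := hlt y hyp
    have h1 := h.front x hx y hy hyp'
    have h2 := h.front x hx w hw hp
    have h3 := h.cls_of_not_mem y hy hyp' hyS.1
    have h4 := h.segment _ _ hyp' le_rfl (h.pos_lt y hy)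
    rw [h.ord_pos y hy] at h4
    have h5 := h.ord_pos y hy
    rw [hpos, hpos]
    grind

theorem RoundInv.lt_pos_iff (h : RoundInv n i P₀ S P) (h₀ : P₀.IsPerm n) (hi : i < n) {v : ℕ}
    (hv : v < n) : i < P.pos v ↔ i < P₀.pos v := by
  rw [← not_iff_not, not_lt, not_lt]
  constructor
  · intro h1
    have h2 := h.ord_eq _ h1
    rw [h.ord_pos v hv] at h2
    rw [h2, h₀.pos_ord _ (by omega)]
    exact h1
  · intro h1
    have h2 := h.ord_eq _ h1
    rw [h₀.ord_pos v hv] at h2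
    rw [← h2, h.pos_ord _ (by omega)]
    exact h1

theorem RoundInv.pos_le (h : RoundInv n i P₀ S P) {d : ℕ} (hd : d ≤ i) (hi : i < n) :
    P.pos (P₀.ord d) = d := by
  rw [← h.ord_eq d hd, h.pos_ord d (by omega)]

/-- Once exactly the later neighbours of the pivot have been split off, two vertices share a class
iff they did before and the pivot does not distinguish them. Within an old class neighbours come
first; between old classes the order is unchanged. -/
theorem Inv.round (h₀ : P₀.Inv A n i) (hi : i < n)
    (h : RoundInv n i P₀ (fun x => x < n ∧ i < P₀.pos x ∧ A (P₀.ord i) x) P) :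
    P.Inv A n (i + 1) := by
  have hlt : ∀ {v}, v < n → (i < P.pos v ↔ i < P₀.pos v) := fun hv => h.lt_pos_iff h₀.toIsPerm hi hv
  have hmixed : ∀ x < n, ∀ y < n, i < P.pos x → i < P.pos y → P.cls x = P.cls y →
      P₀.cls x = P₀.cls y ∧ (A (P₀.ord i) x ↔ A (P₀.ord i) y) := by
    intro x hx y hy hxp hyp hxy
    have h1 := h.of_mem x
    have h2 := h.of_mem y
    have h3 := h.cls_of_not_mem x hx hxp
    have h4 := h.cls_of_not_mem y hy hyp
    have h5 := h.cls_lt₀ x hx hxp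
    have h6 := h.cls_lt₀ y hy hyp
    have h7 := h.stamped (P₀.cls x)
    have h8 := h.stamped (P₀.cls y)
    have h9 := h.inj (P₀.cls x) (P₀.cls y)
    have := (hlt hx).1 hxp
    have := (hlt hy).1 hyp
    grind
  have hbefore : ∀ x < n, ∀ y < n, i < P.pos x → P.pos x < P.pos y → P₀.cls x ≠ P₀.cls y →
      P₀.pos x < P₀.pos y := by
    intro x hx y hy hxp hxy hne
    by_contra hcon
    have hne' : P₀.pos x ≠ P₀.pos y := by
      intro heq
      rw [← h₀.ord_pos x hx, heq, h₀.ord_pos y hy] at hne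
      exact hne rfl
    have := h.before y hy x hx (by omega) hxp hne.symm (by omega)
    omega
  -- For the new pivot `a = i`: within one old class `front` forbids the situation, and for two old
  -- classes `diff` supplies the earlier witness.
  have hlex : ∀ x < n, ∀ y < n, i < P.pos x → P.pos x < P.pos y → ∀ a ≤ i, A (P₀.ord a) y →
      ¬ A (P₀.ord a) x → ∃ d < a, A (P₀.ord d) x ∧ ¬ A (P₀.ord d) y := by
    intro x hx y hy hxp hxy a ha hay hax
    have hxp' := (hlt hx).1 hxp
    have hyp' := (hlt hy).1 (hxp.trans hxy)
    by_cases hc : P₀.cls x = P₀.cls y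
    · rcases ha.eq_or_lt with rfl | ha
      · have := h.front y hy x hx hxp ⟨hy, hyp', hay⟩ (fun h => hax h.2.2) hc.symm
        omega
      · exact absurd ((h₀.same x hx y hy hxp'.le hyp'.le hc a ha).2 hay) hax
    · have hb := hbefore x hx y hy hxp hxy hc
      rcases ha.eq_or_lt with rfl | ha
      · exact h₀.diff x hx y hy hxp'.le hb hc
      · exact h₀.lex x hx y hy hxp'.le hb a ha hay hax
  refine { h.toIsPerm with
      cls_lt := fun v hv hp => h.cls_lt hv hp, stamp_le := h.stamp_le,
      le_head := h.lt_head, segment := h.segment, same := ?_, lex := ?_, diff := ?_, done := ?_ }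
  · intro x hx y hy hxp hyp hxy d hd
    obtain ⟨h1, h2⟩ := hmixed x hx y hy hxp hyp hxy
    rw [h.ord_eq d (by omega)]
    rcases (Nat.lt_succ_iff.1 hd).eq_or_lt with rfl | hd'
    · exact h2
    · exact h₀.same x hx y hy ((hlt hx).1 hxp).le ((hlt hy).1 hyp).le h1 d hd'
  · intro x hx y hy hxp hxy a ha hay hax
    rw [h.ord_eq a (by omega)] at hay hax
    obtain ⟨d, hd, h1⟩ := hlex x hx y hy hxp hxy a (by omega) hay hax
    exact ⟨d, hd, by rwa [h.ord_eq d (by omega)]⟩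
  · intro x hx y hy hxp hxy hne
    have hxp' := (hlt hx).1 hxp
    have hyp' := (hlt hy).1 (lt_trans (Nat.lt_of_succ_le hxp) hxy)
    by_cases hc : P₀.cls x = P₀.cls y
    · have h1 := h.of_mem x
      have h2 := h.of_mem y
      have h3 := h.cls_of_not_mem x hx hxp
      have h4 := h.cls_of_not_mem y hy (by omega)
      have h5 := h.front y hy x hx hxp
      refine ⟨i, by omega, ?_⟩
      rw [h.ord_eq i le_rfl]
      grind
    · obtain ⟨d, hd, h1⟩ := h₀.diff x hx y hy hxp'.le (hbefore x hx y hy hxp hxy hc) hc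
      exact ⟨d, by omega, by rwa [h.ord_eq d (by omega)]⟩
  · intro a b hab hbi y hy hby hay hab'
    rw [h.ord_eq a (by omega)] at hay hab'
    rw [h.ord_eq b (by omega)] at hab' ⊢
    have hb' := h₀.pos_ord b (by omega)
    have hb'' := h₀.ord_lt b (by omega)
    have hby' : b < P₀.pos y := by
      by_contra hcon
      have := h.pos_le (d := P₀.pos y) (by omega) hi
      rw [h₀.ord_pos y hy] at this
      omega
    obtain ⟨d, hd, h1⟩ : ∃ d < a, A (P₀.ord d) (P₀.ord b) ∧ ¬ A (P₀.ord d) y := by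
      rcases (Nat.lt_succ_iff.1 hbi).eq_or_lt with rfl | hbi'
      · exact h₀.lex _ hb'' y hy hb'.ge (by omega) a hab hay hab'
      · exact h₀.done a b hab hbi' y hy hby' hay hab'
    exact ⟨d, hd, by rwa [h.ord_eq d (by omega)]⟩

theorem Inv.isLexBFSOrdering (h : P.Inv A n n) {k : ℕ} (hk : k < n) :
    IsLexBFSOrdering (fun i j => A (P.ord i) (P.ord j)) k := fun a b c hab hbc hck =>
  h.done a b hab (by omega) (P.ord c) (h.ord_lt c (by omega)) (by rwa [h.pos_ord c (by omega)])

theorem inv_zero {P : Partition} (hord : ∀ v < n, P.ord v = v) (hpos : ∀ v < n, P.pos v = v)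
    (hcls : ∀ v < n, P.cls v = 0) (hhead : P.head 0 = 0) (hstamp : ∀ c, P.stamp c = 0)
    (hfresh : 0 < P.fresh) : P.Inv A n 0 where
  ord_lt p hp := by rwa [hord p hp]
  pos_lt p hp := by rwa [hpos p hp]
  pos_ord p hp := by rw [hord p hp, hpos p hp]
  ord_pos p hp := by rw [hpos p hp, hord p hp]
  cls_lt v hv _ := by rwa [hcls v hv]
  stamp_le c := (hstamp c).le
  le_head _ _ _ := Nat.zero_le _
  segment p q _ hpq hq := by
    rw [hord q hq, hord p (by omega), hcls q hq, hcls p (by omega), hhead]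
    simp
  same _ _ _ _ _ _ _ _ hd := absurd hd (Nat.not_lt_zero _)
  lex _ _ _ _ _ _ _ hd := absurd hd (Nat.not_lt_zero _)
  diff x hx y hy _ _ hne := absurd ((hcls x hx).trans (hcls y hy).symm) hne
  done _ _ _ hb := absurd hb (Nat.not_lt_zero _)

end Partition

/-! ### The program for lexicographic breadth-first search

Register `0` holds the number `n` of vertices and register `1` the number `1`. The data of partition
refinement are in the arrays `12, …, 17` and in register `3`, the round is in register `2`. -/

/-- The adjacency lists of the relation `A` on the numbers below `n`. -/
structure IsAdjacencyList (A : ℕ → ℕ → Prop) (n : ℕ) (off adj : ℕ → ℕ) : Prop where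
  off_zero : off 0 = 0
  mono : ∀ v < n, off v ≤ off (v + 1)
  inj : ∀ v < n, ∀ j, off v ≤ j → j < off (v + 1) → ∀ j', off v ≤ j' → j' < off (v + 1) →
    adj j = adj j' → j = j'
  mem : ∀ v < n, ∀ w, A v w ↔ ∃ j, off v ≤ j ∧ j < off (v + 1) ∧ adj j = w

/-- The partition refinement data in a memory. -/
def State.partition (s : State) : Partition :=
  ⟨s.arr 12, s.arr 13, s.arr 14, s.arr 15, s.arr 16, s.arr 17, s.reg 3⟩

/-- The memory `s` holds the same input as `s₀`, and the number `1`. -/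
structure SameInput (s₀ s : State) : Prop where
  reg_zero : s.reg 0 = s₀.reg 0
  reg_one : s.reg 1 = 1
  arr_zero : s.arr 0 = s₀.arr 0
  arr_one : s.arr 1 = s₀.arr 1
  arr_two : s.arr 2 = s₀.arr 2
  arr_three : s.arr 3 = s₀.arr 3

/-- Find or create the class for the vertices split off the class in register `11`. -/
def touchProgram : Program := block [
  .load 12 16 11,
  .ifLt 12 6
    (block [.store 16 11 6, .store 17 11 3, .load 13 15 11, .store 15 3 13, .add 3 3 1])
    .skip]

/-- Split the vertex in register `9`, at the position in register `10`, off its class, which is in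
register `11`. -/
def moveProgram : Program := block [
  .load 13 15 11, .load 14 12 13,
  .store 12 10 14, .store 13 14 10, .store 12 13 9, .store 13 9 13,
  .add 15 13 1, .store 15 11 15, .load 16 17 11, .store 14 9 16]

/-- Treat the neighbour in cell `reg 7` of the adjacency lists. -/
def refineProgram : Program := block [
  .load 9 1 7, .load 10 13 9,
  .ifLt 2 10 (block [.load 11 14 9, touchProgram, moveProgram]) .skip,
  .add 7 7 1]

/-- A round of partition refinement. -/
def roundProgram : Program := block [
  .load 4 12 2, .load 5 14 4, .add 6 2 1, .store 15 5 6, .load 7 0 4, .add 8 4 1, .load 8 0 8,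
  .whileLt 7 8 refineProgram,
  .copy 2 6]

/-- Lexicographic breadth-first search. -/
def lexBFSProgram : Program := block [
  .const 1 1, .const 3 1, .const 2 0,
  .whileLt 2 0 (block [.store 12 2 2, .store 13 2 2, .add 2 2 1]),
  .const 2 0,
  .whileLt 2 0 roundProgram]

/-! ### Correctness and running time of lexicographic breadth-first search -/

variable {A : ℕ → ℕ → Prop} {B n i : ℕ} {s₀ s : State}

theorem vc_touchProgram (h6 : s.reg 6 = i + 1)
    (h1 : s.reg 1 = 1) (hB : s.reg 3 + 1 ≤ B) :
    vc B touchProgram s fun t s' => t ≤ 10 ∧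
      s'.partition = s.partition.touch i (s.reg 11) ∧ s'.arr 0 = s.arr 0 ∧ s'.arr 1 = s.arr 1 ∧
      s'.arr 2 = s.arr 2 ∧ s'.arr 3 = s.arr 3 ∧ s'.reg 3 ≤ s.reg 3 + 1 ∧
      ∀ x, x ≠ 3 → x ≠ 12 → x ≠ 13 → s'.reg x = s.reg x := by
  simp only [touchProgram, block, vc, Partition.touch, State.partition]
  constructor
  · intro hlt
    simp at hlt
    rw [h6] at hlt
    simp [h1, h6, hlt, hB]
    grind
  · intro hlt
    simp at hlt
    rw [h6] at hlt
    simp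
    grind

theorem vc_moveProgram (h1 : s.reg 1 = 1) (h10 : s.reg 10 = s.arr 13 (s.reg 9))
    (h11 : s.reg 11 = s.arr 14 (s.reg 9)) (hB : s.arr 15 (s.reg 11) + 1 ≤ B) :
    vc B moveProgram s fun t s' => t ≤ 10 ∧
      s'.partition = s.partition.move (s.reg 9) ∧ s'.arr 0 = s.arr 0 ∧ s'.arr 1 = s.arr 1 ∧
      s'.arr 2 = s.arr 2 ∧ s'.arr 3 = s.arr 3 ∧
      ∀ x, x < 10 → s'.reg x = s.reg x := by
  simp only [moveProgram, block, vc, Partition.move, State.partition]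
  simp [h1, h10, h11] at *
  refine ⟨hB, fun x hx => ?_⟩
  grind

/-- Neighbours at or before the pivot are skipped, so only later ones join the split set. The caller
obtains `hS` from the fact that each neighbour is listed once. -/
theorem vc_refineProgram {P₀ : Partition} {S : ℕ → Prop} {w : ℕ}
    (h : Partition.RoundInv n i P₀ S s.partition) (hin : SameInput s₀ s) (h2 : s.reg 2 = i)
    (h6 : s.reg 6 = i + 1) (hw : s.arr 1 (s.reg 7) = w) (hwn : w < n)
    (hS : i < s.partition.pos w → ¬ S w) (hB : s.reg 3 + 1 ≤ B) (hB' : n + 1 ≤ B)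
    (hB'' : s.reg 7 + 1 ≤ B) :
    vc B refineProgram s fun t s' => t ≤ 39 ∧
      Partition.RoundInv n i P₀ (fun x => S x ∨ x = w ∧ i < s.partition.pos w) s'.partition ∧
      SameInput s₀ s' ∧ s'.reg 3 ≤ s.reg 3 + 1 ∧ s'.reg 7 = s.reg 7 + 1 ∧ s'.reg 2 = s.reg 2 ∧
      s'.reg 6 = s.reg 6 ∧ s'.reg 8 = s.reg 8 := by
  have hpos : s.arr 13 w = s.partition.pos w := rfl
  simp only [refineProgram, block, vc]
  constructor
  · intro hlt
    simp [h2, hw, hpos] at hlt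
    obtain ⟨hT, hst⟩ := h.touch hwn hlt (hS hlt)
    refine (vc_touchProgram (i := i) (by simpa using h6) (by simpa using hin.reg_one)
      (by simpa using hB)).mono fun t s₁ hs₁ => ?_
    obtain ⟨ht, hp, ha0, ha1, ha2, ha3, hr3, hr⟩ := hs₁
    have hr9 : s₁.reg 9 = w := by rw [hr 9 (by decide) (by decide) (by decide)]; simp [hw]
    have hr11 : s₁.reg 11 = s.partition.cls w := by
      rw [hr 11 (by decide) (by decide) (by decide)]; simp [hw, State.partition]
    have hp' : s₁.partition = s.partition.touch i (s.partition.cls w) := by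
      rw [hp]; simp [hw, State.partition]
    have hcls : s₁.arr 14 = s.arr 14 := by
      change s₁.partition.cls = s.partition.cls
      rw [hp', Partition.touch]
      split <;> rfl
    have hps : s₁.arr 13 = s.arr 13 := by
      change s₁.partition.pos = s.partition.pos
      rw [hp', Partition.touch]
      split <;> rfl
    have hcw : s₁.partition.cls w = s.partition.cls w := congrFun hcls w
    rw [← hp'] at hT hst
    have hM := hT.move hwn (by rw [hp', Partition.touch]; split <;> exact hlt) (hS hlt)
      (by rw [hcw]; exact hst)
    -- A class containing `w` starts no later than the position of `w`, so its advanced head still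
    -- fits into a word.
    have hhead : s₁.partition.head (s₁.partition.cls w) ≤ n := by
      have h1 := hT.pos_lt w hwn
      have h2 := hT.segment _ _ (show i < s₁.partition.pos w by
        rw [hp', Partition.touch]; split <;> exact hlt) le_rfl h1
      rw [hT.ord_pos w hwn] at h2
      have := h2.1 rfl
      omega
    refine (vc_moveProgram ?_ ?_ ?_ ?_).mono fun t' s₂ hs₂ => ?_
    · rw [hr 1 (by decide) (by decide) (by decide)]
      simpa using hin.reg_one
    · rw [hr 10 (by decide) (by decide) (by decide), hr9, hps]
      simp [hw]
    · rw [hr11, hr9, hcls]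
      rfl
    · rw [hr11, ← hcw]
      exact (Nat.succ_le_succ hhead).trans hB'
    obtain ⟨ht', hp'', ha0', ha1', ha2', ha3', hr'⟩ := hs₂
    have hr'' : ∀ x, x < 9 → x ≠ 3 → s₂.reg x = s.reg x := by
      intro x hx hx3
      rw [hr' x (by omega), hr x hx3 (by omega) (by omega)]
      simp
      grind
    have hr3' : s₂.reg 3 ≤ s.reg 3 + 1 := by
      rw [hr' 3 (by omega)]
      simpa using hr3
    rw [hr9] at hp''
    have e0 := hr'' 0 (by decide) (by decide)
    have e1 := hr'' 1 (by decide) (by decide)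
    have e2 := hr'' 2 (by decide) (by decide)
    have e6 := hr'' 6 (by decide) (by decide)
    have e7 := hr'' 7 (by decide) (by decide)
    have e8 := hr'' 8 (by decide) (by decide)
    simp only [State.arr_setReg] at ha0 ha1 ha2 ha3
    refine ⟨by rw [e7, e1, hin.reg_one]; exact hB'', by omega, ?_, ⟨?_, ?_, ?_, ?_, ?_, ?_⟩, ?_, ?_, ?_, ?_, ?_⟩
    · have : ∀ k, (s₂.setReg 7 k).partition = s₂.partition := fun k => by
        simp [State.partition]
      rw [this, hp'']
      convert hM using 2 with x
      simp [hlt]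
    all_goals simp [e0, e1, e2, e6, e7, e8, hin.reg_zero, hin.reg_one, ha0', ha0, ha1', ha1, ha2',
      ha2, ha3', ha3, hin.arr_zero, hin.arr_one, hin.arr_two, hin.arr_three, hr3']
  · intro hlt
    simp [h2, hw, hpos] at hlt
    simp [hin.reg_one, hB'']
    refine ⟨?_, ⟨?_, ?_, ?_, ?_, ?_, ?_⟩⟩
    · have hp : (((s.setReg 9 (s.arr 1 (s.reg 7))).setReg 10
          (s.arr 13 (s.arr 1 (s.reg 7)))).setReg 7 (s.reg 7 + 1)).partition = s.partition := by
        simp [State.partition]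
      rw [hp]
      convert h using 2 with x
      simp
      omega
    all_goals simp [hin.reg_zero, hin.reg_one, hin.arr_zero, hin.arr_one, hin.arr_two,
      hin.arr_three]

/-- For amortization: a round removes exactly its pivot from the unprocessed vertices, so it may
spend the weight of the pivot. -/
theorem Partition.RoundInv.sum_filter {P P₀ : Partition} {S : ℕ → Prop}
    (h : Partition.RoundInv n i P₀ S P) (h₀ : P₀.IsPerm n) (hi : i < n) (f : ℕ → ℕ) :
    ∑ x ∈ Finset.range n with i ≤ P₀.pos x, f x =
      f (P₀.ord i) + ∑ x ∈ Finset.range n with i + 1 ≤ P.pos x, f x := by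
  have heq : (Finset.range n).filter (fun x => i ≤ P₀.pos x) =
      insert (P₀.ord i) ((Finset.range n).filter fun x => i + 1 ≤ P.pos x) := by
    ext x
    simp only [Finset.mem_filter, Finset.mem_range, Finset.mem_insert]
    constructor
    · rintro ⟨hx, hix⟩
      rcases hix.eq_or_lt with h' | h'
      · left
        rw [h', h₀.ord_pos x hx]
      · exact .inr ⟨hx, (h.lt_pos_iff h₀ hi hx).2 h'⟩
    · rintro (rfl | ⟨hx, hix⟩)
      · exact ⟨h₀.ord_lt i hi, (h₀.pos_ord i hi).ge⟩
      · exact ⟨hx, ((h.lt_pos_iff h₀ hi hx).1 hix).le⟩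
  rw [heq, Finset.sum_insert]
  simp only [Finset.mem_filter, not_and]
  intro _
  rw [h.pos_le le_rfl hi]
  omega

/-- The number of vertices adjacent to `v`. -/
def degree (s : State) (v : ℕ) : ℕ := s.arr 0 (v + 1) - s.arr 0 v

theorem IsAdjacencyList.sum_degree (h : IsAdjacencyList A n (s.arr 0) (s.arr 1)) :
    ∑ x ∈ Finset.range n, degree s x = s.arr 0 n := by
  have : ∀ k ≤ n, ∑ x ∈ Finset.range k, degree s x = s.arr 0 k := by
    intro k
    induction k with
    | zero => simp [h.off_zero]
    | succ k ih =>
      intro hk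
      rw [Finset.sum_range_succ, ih (by omega), degree]
      have := h.mono k hk
      omega
  exact this n le_rfl

theorem IsAdjacencyList.le (h : IsAdjacencyList A n (s.arr 0) (s.arr 1)) {v : ℕ} (hv : v < n) :
    s.arr 0 (v + 1) ≤ s.arr 0 n := by
  have : ∀ k, v + 1 + k ≤ n → s.arr 0 (v + 1) ≤ s.arr 0 (v + 1 + k) := by
    intro k
    induction k with
    | zero => simp
    | succ k ih => exact fun hk => (ih (by omega)).trans (h.mono _ (by omega))
  have h1 := this (n - (v + 1)) (by omega)
  rwa [Nat.add_sub_cancel' hv] at h1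

theorem vc_roundProgram (hA : IsAdjacencyList A n (s₀.arr 0) (s₀.arr 1))
    (hn : ∀ u v, A u v → v < n) (h : s.partition.Inv A n i) (hin : SameInput s₀ s)
    (h2 : s.reg 2 = i) (hi : i < n) (hB : s.reg 3 + degree s₀ (s.partition.ord i) + 1 ≤ B)
    (hB' : s₀.arr 0 n + n + 1 ≤ B) :
    vc B roundProgram s fun t s' => t ≤ 20 + 40 * degree s₀ (s.partition.ord i) ∧
      s'.partition.Inv A n (i + 1) ∧ SameInput s₀ s' ∧ s'.reg 2 = i + 1 ∧
      s'.reg 3 ≤ s.reg 3 + degree s₀ (s.partition.ord i) ∧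
      ∀ f : ℕ → ℕ, ∑ x ∈ Finset.range n with i ≤ s.partition.pos x, f x =
        f (s.partition.ord i) + ∑ x ∈ Finset.range n with i + 1 ≤ s'.partition.pos x, f x := by
  obtain ⟨v, hv⟩ : ∃ v, s.partition.ord i = v := ⟨_, rfl⟩
  have hvn : v < n := hv ▸ h.ord_lt i hi
  have hv' : s.arr 12 i = v := hv
  have hmono := hA.mono v hvn
  have hle := hA.le hvn
  rw [hv] at hB ⊢
  simp only [roundProgram, block, vc]
  simp only [degree] at *
  refine ⟨by simp [hin.reg_one, h2]; omega, by simp [hin.reg_one, h2, hv']; omega, ?_⟩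
  -- Each neighbour costs 39 steps and one comparison, and creates at most one class; the bound on
  -- register `3` records the latter.
  refine (Terminates.whileLt (fun m s' => SameInput s₀ s' ∧ s'.reg 2 = i ∧ s'.reg 6 = i + 1 ∧
    s'.reg 8 = s₀.arr 0 (v + 1) ∧ s₀.arr 0 v ≤ s'.reg 7 ∧ s'.reg 7 ≤ s₀.arr 0 (v + 1) ∧
    s'.reg 3 ≤ s.reg 3 + (s'.reg 7 - s₀.arr 0 v) ∧ m = 40 * (s₀.arr 0 (v + 1) - s'.reg 7) ∧
    Partition.RoundInv n i s.partition (fun x => i < s.partition.pos x ∧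
      ∃ j, s₀.arr 0 v ≤ j ∧ j < s'.reg 7 ∧ s₀.arr 1 j = x) s'.partition) ?_
      (40 * (s₀.arr 0 (v + 1) - s₀.arr 0 v)) _ ?_).mono ?_
  · rintro m s₁ ⟨g1, g2, g3, g4, g5, g6, g7, g8, g9⟩ hlt
    rw [g4] at hlt
    have hw : s₀.arr 1 (s₁.reg 7) < n := hn v _ ((hA.mem v hvn _).2 ⟨_, g5, hlt, rfl⟩)
    refine terminates_of_vc ((vc_refineProgram (w := s₀.arr 1 (s₁.reg 7)) g9 g1 g2 g3
      (by rw [g1.arr_one]) hw ?_ (by omega) (by omega) (by omega)).mono ?_)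
    · rintro - ⟨-, j, hj, hj', hjw⟩
      have := hA.inj v hvn j hj (by omega) _ g5 hlt hjw
      omega
    · rintro t s₂ ⟨k1, k2, k3, k4, k5, k6, k7, k8⟩
      refine ⟨_, ⟨k3, by omega, by omega, by omega, by omega, by omega, by omega, rfl, ?_⟩,
        by omega⟩
      convert k2 using 2 with x
      rw [k5, g9.lt_pos_iff h.toIsPerm hi hw]
      constructor
      · rintro ⟨hx, j, hj, hj', rfl⟩
        rcases (Nat.lt_succ_iff.1 hj').eq_or_lt with rfl | hj'
        · exact .inr ⟨rfl, hx⟩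
        · exact .inl ⟨hx, j, hj, hj', rfl⟩
      · rintro (⟨hx, j, hj, hj', rfl⟩ | ⟨rfl, hx⟩)
        · exact ⟨hx, j, hj, by omega, rfl⟩
        · exact ⟨hx, _, g5, by omega, rfl⟩
  · have hp : (((((((s.setReg 4 v).setReg 5 (s.arr 14 v)).setReg 6 (i + 1)).setArr 15
        (s.arr 14 v) (i + 1)).setReg 7 (s.arr 0 v)).setReg 8 (v + 1)).setReg 8
        (s.arr 0 (v + 1))).partition = s.partition.pivot i := by
      simp [State.partition, Partition.pivot, hv']
    simp [h2, hv', hin.reg_one]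
    refine ⟨⟨?_, ?_, ?_, ?_, ?_, ?_⟩, ?_, ?_, ?_, ?_⟩
    case refine_10 =>
      rw [hp, hin.arr_zero]
      have hS : (fun x => i < s.partition.pos x ∧
          ∃ j, s₀.arr 0 v ≤ j ∧ j < s₀.arr 0 v ∧ s₀.arr 1 j = x) = fun _ => False := by
        ext x
        rw [iff_false]
        rintro ⟨-, j, h1, h2, -⟩
        omega
      rw [hS]
      exact ⟨rfl, h.pivot⟩
    all_goals simp [hin.reg_zero, hin.reg_one, hin.arr_zero, hin.arr_one, hin.arr_two,
      hin.arr_three, hmono]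
  · rintro t s' ⟨m', ⟨g1, g2, g3, g4, g5, g6, g7, g8, g9⟩, hlt, ht⟩
    have g7' : s'.reg 7 = s₀.arr 0 (v + 1) := by omega
    have hp : (s'.setReg 2 (s'.reg 6)).partition = s'.partition := by simp [State.partition]
    rw [hp]
    refine ⟨by omega, ?_, ⟨?_, ?_, ?_, ?_, ?_, ?_⟩, by simp [g3], by simp; omega, fun f => ?_⟩
    · refine h.round hi ?_
      convert g9 using 2 with x
      rw [g7', hv, hA.mem v hvn]
      constructor
      · exact fun hx => hx.2
      · rintro ⟨hx, hj⟩
        exact ⟨hn v x ((hA.mem v hvn _).2 hj), hx, hj⟩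
    case refine_8 => rw [g9.sum_filter h.toIsPerm hi, hv]
    all_goals simp [g1.reg_zero, g1.reg_one, g1.arr_zero, g1.arr_one, g1.arr_two, g1.arr_three]

theorem vc_lexBFSProgram (hA : IsAdjacencyList A n (s.arr 0) (s.arr 1))
    (hn : ∀ u v, A u v → v < n) (h0 : s.reg 0 = n) (hstamp : ∀ c, s.arr 16 c = 0)
    (hcls : ∀ c, s.arr 14 c = 0) (hhead : ∀ c, s.arr 15 c = 0)
    (hB : s.arr 0 n + n + 1 ≤ B) :
    vc B lexBFSProgram s fun t s' => t ≤ 40 * (s.arr 0 n + n + 1) ∧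
      s'.partition.Inv A n n ∧ SameInput s s' := by
  simp only [lexBFSProgram, block, vc]
  refine ⟨by omega, by omega, by omega, ?_⟩
  refine (Terminates.whileLt (fun m s' => SameInput s s' ∧ s'.reg 3 = 1 ∧ s'.reg 2 ≤ n ∧
    (∀ c, s'.arr 16 c = 0) ∧ (∀ c, s'.arr 14 c = 0) ∧ (∀ c, s'.arr 15 c = 0) ∧
    m = 4 * (n - s'.reg 2) ∧ ∀ v < s'.reg 2, s'.arr 12 v = v ∧ s'.arr 13 v = v) ?_
      (4 * n) _ ?_).mono ?_
  · rintro m s₁ ⟨g1, g2, g3, g4, g5, g6, g7, g8⟩ hlt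
    rw [g1.reg_zero, h0] at hlt
    apply terminates_of_vc
    simp only [vc]
    refine ⟨by simp [g1.reg_one]; omega, _, ⟨⟨?_, ?_, ?_, ?_, ?_, ?_⟩, ?_, ?_, ?_, ?_, ?_, rfl, ?_⟩,
      by simp [g1.reg_one]; omega⟩
    case refine_12 =>
      simp [g1.reg_one, Function.update_apply]
      intro v hv
      have := g8 v
      grind
    all_goals simp [g1.reg_zero, g1.reg_one, g1.arr_zero, g1.arr_one, g1.arr_two, g1.arr_three,
      g2, g4, g5, g6]
    omega
  · refine ⟨⟨?_, ?_, ?_, ?_, ?_, ?_⟩, ?_, ?_, ?_, ?_, ?_, ?_, ?_⟩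
    all_goals simp [hstamp, hcls, hhead]
  · rintro t s₁ ⟨m₁, ⟨g1, g2, g3, g4, g5, g6, g7, g8⟩, hlt, ht⟩
    rw [g1.reg_zero, h0] at hlt
    have g8' : ∀ v < n, s₁.arr 12 v = v ∧ s₁.arr 13 v = v := fun v hv => g8 v (by omega)
    refine ⟨by omega, ?_⟩
    -- Classes created so far plus degrees of unprocessed vertices never exceed the total degree
    -- plus one, so class numbers fit into words. The weight `22 + 40 * degree` pays for a round and
    -- its comparison.
    refine (Terminates.whileLt (fun m s' => SameInput s s' ∧ s'.reg 2 ≤ n ∧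
      s'.partition.Inv A n (s'.reg 2) ∧
      s'.reg 3 + ∑ x ∈ Finset.range n with s'.reg 2 ≤ s'.partition.pos x, degree s x ≤
        s.arr 0 n + 1 ∧
      m = ∑ x ∈ Finset.range n with s'.reg 2 ≤ s'.partition.pos x, (22 + 40 * degree s x)) ?_
        (∑ x ∈ Finset.range n, (22 + 40 * degree s x)) _ ?_).mono ?_
    · rintro m s₂ ⟨k1, k2, k3, k4, rfl⟩ hlt
      rw [k1.reg_zero, h0] at hlt
      have hsum : degree s (s₂.partition.ord (s₂.reg 2)) ≤
          ∑ x ∈ Finset.range n with s₂.reg 2 ≤ s₂.partition.pos x, degree s x :=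
        Finset.single_le_sum (fun _ _ => Nat.zero_le _) (Finset.mem_filter.2
          ⟨Finset.mem_range.2 (k3.ord_lt _ hlt), (k3.pos_ord _ hlt).ge⟩)
      refine terminates_of_vc ((vc_roundProgram hA hn k3 k1 rfl hlt (by omega) hB).mono ?_)
      rintro t s₃ ⟨l1, l2, l3, l4, l5, l6⟩
      rw [l6] at k4
      refine ⟨_, ⟨l3, by omega, l4 ▸ l2, by rw [l4]; omega, rfl⟩, ?_⟩
      rw [l6 fun x => 22 + 40 * degree s x, l4]
      omega
    · have hp : (s₁.setReg 2 0).partition = s₁.partition := by simp [State.partition]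
      rw [hp]
      have hf : ((Finset.range n).filter fun x => 0 ≤ s₁.partition.pos x) = Finset.range n := by
        simp
      refine ⟨⟨?_, ?_, ?_, ?_, ?_, ?_⟩, ?_, ?_, ?_, ?_⟩
      case refine_8 =>
        refine Partition.inv_zero (fun v hv => (g8' v hv).1) (fun v hv => (g8' v hv).2)
          (fun v _ => g5 v) (g6 0) g4 ?_
        change 0 < s₁.reg 3
        omega
      case refine_9 =>
        simp [hA.sum_degree, g2]
        omega
      all_goals simp [g1.reg_zero, g1.reg_one, g1.arr_zero, g1.arr_one, g1.arr_two, g1.arr_three]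
    · rintro t' s₂ ⟨m₂, ⟨k1, k2, k3, k4, k5⟩, hlt, ht'⟩
      rw [k1.reg_zero, h0] at hlt
      have : s₂.reg 2 = n := by omega
      rw [this] at k3
      refine ⟨?_, k3, k1⟩
      rw [Finset.sum_add_distrib, ← Finset.mul_sum, hA.sum_degree] at ht'
      simp at ht'
      omega

/-! ### The program that makes the two perfect matchings agree -/

/-- The arrays `f` and `g` of partners have been obtained from `M` and `N` by the flips in the lists
`L` and `L'`. -/
structure IsProgress {V : Type*} {G : SimpleGraph V} (φ : V ↪ ℕ) (n : ℕ) (M N : G.Subgraph)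
    (f g : ℕ → ℕ) (L L' : List (ℕ × ℕ × ℕ × ℕ)) : Prop where
  left : IsMate (G.map φ) n f
  right : IsMate (G.map φ) n g
  flips_left : IsFlipList φ L M (mateSubgraph φ G f)
  flips_right : IsFlipList φ L' N (mateSubgraph φ G g)
  length_le : L.length + L'.length + ((Finset.range n).filter fun u => f u ≠ g u).card ≤ n

section
variable {V : Type*} {G : SimpleGraph V} {φ : V ↪ ℕ} {n : ℕ} {M N : G.Subgraph} {f g : ℕ → ℕ}
  {L L' : List (ℕ × ℕ × ℕ × ℕ)}

theorem IsProgress.symm (h : IsProgress φ n M N f g L L') : IsProgress φ n N M g f L' L :=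
  ⟨h.right, h.left, h.flips_right, h.flips_left, by
    have := h.length_le
    simp only [ne_comm (a := f _)] at this
    omega⟩

/-- The total weight of the vertices whose partners in `f` and `g` differ. -/
def disagreement (n : ℕ) (w f g : ℕ → ℕ) : ℕ := ∑ u ∈ Finset.range n with f u ≠ g u, w u

theorem disagreement_comm (w : ℕ → ℕ) : disagreement n w f g = disagreement n w g f := by
  simp only [disagreement, ne_comm]

/-- The flip removes `g z` from the set of disagreement and adds nothing to it. With degrees as
weights this pays for a scan; with weight 1 it bounds the number of flips. -/
theorem IsMate.disagreement_flip {H : SimpleGraph ℕ} (hH : ∀ u v, H.Adj u v → u < n)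
    (hf : IsMate H n f) (hg : IsMate H n g) {z : ℕ} (hz : z < n) (hne : f z ≠ g z) (w : ℕ → ℕ) :
    disagreement n w (flipMate f z (f z) (f (g z)) (g z)) g + w (g z) ≤
      disagreement n w f g := by
  have hgz := hg z hz
  have hfgz := hf _ (hH _ _ hgz.1.symm)
  rw [disagreement, disagreement, add_comm, ← Finset.sum_insert (a := g z)]
  · refine Finset.sum_le_sum_of_subset fun u hu => ?_
    rw [Finset.mem_insert, Finset.mem_filter, Finset.mem_range] at hu
    rw [Finset.mem_filter, Finset.mem_range]
    rcases hu with rfl | ⟨hu, hu'⟩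
    · have := hf z hz
      exact ⟨hH _ _ hgz.1.symm, by grind⟩
    · exact ⟨hu, (hf.flip_agree hH hg hz hne hu hu').1⟩
  · intro hu
    rw [Finset.mem_filter, Finset.mem_range] at hu
    exact (hf.flip_agree hH hg hz hne hu.1 hu.2).2.2 rfl

theorem IsProgress.flip (hφ : ∀ i, i < n ↔ ∃ v, φ v = i) (h : IsProgress φ n M N f g L L') {z : ℕ}
    (hz : z < n) (hne : f z ≠ g z) (hadj : (G.map φ).Adj (f z) (f (g z))) :
    IsProgress φ n M N (flipMate f z (f z) (f (g z)) (g z)) g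
      (L ++ [(z, f z, f (g z), g z)]) L' := by
  have hH := adj_lt (G := G) hφ
  have hfz := h.left z hz
  have hgz := h.right z hz
  have hfgz := h.left _ (hH _ _ hgz.1.symm)
  have hzfg : z ≠ f (g z) := by grind
  have hflip := (h.left.flip hH hz (hH _ _ hfgz.1.symm) rfl hfgz.2 hadj hgz.1.symm hzfg).1
  refine ⟨hflip, h.right, h.flips_left.append ⟨_, hflip.isPerfectMatching hφ,
      h.left.isFlipAlong hφ hz (hH _ _ hfgz.1.symm) rfl hfgz.2 hadj hgz.1.symm hzfg, rfl⟩,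
    h.flips_right, ?_⟩
  have h1 := h.length_le
  have h2 := h.left.disagreement_flip hH h.right hz hne fun _ => 1
  simp only [disagreement, Finset.sum_const, smul_eq_mul, mul_one] at h2
  simp only [List.length_append, List.length_singleton]
  omega

end

/-- The first `k + 1` positions of a LexBFS ordering form a LexBFS ordering of the subgraph they
induce, which is again an interval graph. -/
theorem Partition.Inv.isSimple {A : ℕ → ℕ → Prop} {n k : ℕ} {P : Partition} (h : P.Inv A n n)
    {l r : ℕ → ℝ} (hm : IsIntervalModel A (· < n) l r) (hsymm : ∀ u v, A u v → A v u)
    (hirr : ∀ u, ¬ A u u) (hk : k < n) :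
    IsSimple A (fun u => u < n ∧ P.pos u ≤ k) (P.ord k) := by
  have hinj : ∀ i ≤ k, ∀ j ≤ k, i ≠ j → P.ord i ≠ P.ord j := by
    intro i hi j hj hij heq
    rw [← h.pos_ord i (by omega), heq, h.pos_ord j (by omega)] at hij
    exact hij rfl
  have h1 : IsSimple (fun i j => A (P.ord i) (P.ord j)) (· ≤ k) k :=
    IsIntervalModel.isSimple_of_isLexBFSOrdering (l := fun i => l (P.ord i))
      (r := fun i => r (P.ord i))
      ⟨fun u hu => hm.le _ (h.ord_lt _ (by omega)), fun u v hu hv huv => hm.adj_iff _ _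
        (h.ord_lt _ (by omega)) (h.ord_lt _ (by omega)) (hinj u hu v hv huv)⟩
      (fun _ _ => hsymm _ _) (fun _ => hirr _) (h.isLexBFSOrdering hk)
  rintro a b ⟨ha, hak⟩ ⟨hb, hbk⟩ hab haz hbz
  have h2 := h1 (P.pos a) (P.pos b) hak hbk
    (fun heq => hab (by rw [← h.ord_pos a ha, heq, h.ord_pos b hb]))
  simp only [h.ord_pos a ha, h.ord_pos b hb] at h2
  refine (h2 haz hbz).imp ?_ ?_
  · rintro h3 x ⟨hx, hxk⟩ hxb hxa
    have := h3 (P.pos x) hxk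
      (fun heq => hxb (by rw [← h.ord_pos x hx, heq, h.ord_pos b hb]))
    rw [h.ord_pos x hx] at this
    exact this hxa
  · rintro h3 x ⟨hx, hxk⟩ hxb hxa
    have := h3 (P.pos x) hxk
      (fun heq => hxb (by rw [← h.ord_pos x hx, heq, h.ord_pos a ha]))
    rw [h.ord_pos x hx] at this
    exact this hxa

/-- The list of the first `k` quadruples stored in the arrays `o, …, o + 3`. -/
def State.quadruples (s : State) (o k : ℕ) : List (ℕ × ℕ × ℕ × ℕ) :=
  (List.range k).map fun i => (s.arr o i, s.arr (o + 1) i, s.arr (o + 2) i, s.arr (o + 3) i)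

theorem State.quadruples_succ (s : State) (o k : ℕ) : s.quadruples o (k + 1) =
    s.quadruples o k ++ [(s.arr o k, s.arr (o + 1) k, s.arr (o + 2) k, s.arr (o + 3) k)] := by
  simp [quadruples, List.range_succ]

theorem State.quadruples_congr {s s' : State} {o k : ℕ} (h : ∀ i < k, s.arr o i = s'.arr o i ∧
    s.arr (o + 1) i = s'.arr (o + 1) i ∧ s.arr (o + 2) i = s'.arr (o + 2) i ∧
    s.arr (o + 3) i = s'.arr (o + 3) i) : s.quadruples o k = s'.quadruples o k := by
  refine List.map_congr_left fun i hi => ?_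
  obtain ⟨h1, h2, h3, h4⟩ := h i (List.mem_range.1 hi)
  rw [h1, h2, h3, h4]

/-- Flip the matching in array `F` along the `4`-cycle in the registers `5`, `b`, `c` and `d`, and
record the flip in the arrays `o, …, o + 3`, where register `k` counts the flips. -/
def flipProgram (F o k b c d : ℕ) : Program := block [
  .store F 5 d, .store F d 5, .store F b c, .store F c b,
  .store o k 5, .store (o + 1) k b, .store (o + 2) k c, .store (o + 3) k d, .add k k 1]

/-- Set register `16` to `1` if the vertex in register `20` is a neighbour of the vertex in register
`19`, and to `0` otherwise. -/
def scanProgram : Program := block [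
  .load 14 0 19, .add 15 19 1, .load 15 0 15, .const 16 0,
  .whileLt 14 15 (block [
    .load 18 1 14,
    .ifLt 18 20 .skip (.ifLt 20 18 .skip (.const 16 1)),
    .add 14 14 1])]

/-- Run `p` or `q` depending on whether the vertices in the registers `u` and `x` are adjacent. -/
def ifAdjProgram (u x : ℕ) (p q : Program) : Program := block [
  .copy 19 u, .copy 20 x, scanProgram, .ifLt 17 16 p q]

/-- Make the partners of the vertex in register `5` agree, where these partners are different and
in the registers `6` and `7`. -/
def agreeProgram : Program := block [
  .load 12 2 7, .load 13 3 6,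
  .load 8 0 6, .add 9 6 1, .load 9 0 9, .sub 9 9 8,
  .load 10 0 7, .add 11 7 1, .load 11 0 11, .sub 11 11 10,
  -- Registers `9` and `11` hold the degrees of the two partners; the shorter list is scanned. If
  -- the test fails, the other flip is possible without a further test.
  .ifLt 11 9
    (ifAdjProgram 7 13 (flipProgram 3 8 4 7 13 6) (flipProgram 2 4 3 6 12 7))
    (ifAdjProgram 6 12 (flipProgram 2 4 3 6 12 7) (flipProgram 3 8 4 7 13 6))]

/-- Make the two perfect matchings in the arrays `2` and `3` agree, using the ordering in array
`12`. -/
def eliminationProgram : Program := block [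
  .const 3 0, .const 4 0, .const 17 0, .copy 2 0,
  .whileLt 17 2 (block [
    .sub 2 2 1, .load 5 12 2, .load 6 2 5, .load 7 3 5,
    .ifLt 6 7 agreeProgram (.ifLt 7 6 agreeProgram .skip)])]

/-- Append the flips in the arrays `8, …, 11`, in reverse order, to those in the arrays
`4, …, 7`. -/
def outputProgram : Program := block [
  .whileLt 17 4 (block [
    .sub 4 4 1,
    .load 5 8 4, .store 4 3 5, .load 5 9 4, .store 5 3 5,
    .load 5 10 4, .store 6 3 5, .load 5 11 4, .store 7 3 5,
    .add 3 3 1]),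
  .copy 0 3]

/-! ### Correctness and running time of the elimination -/

variable {A : ℕ → ℕ → Prop} {B n : ℕ} {s₀ s : State}

/-- The part of the memory that is not changed any more when the ordering has been found. -/
structure SameOrdering (s₀ s : State) : Prop where
  reg_zero : s.reg 0 = s₀.reg 0
  reg_one : s.reg 1 = 1
  reg_seventeen : s.reg 17 = 0
  arr_zero : s.arr 0 = s₀.arr 0
  arr_one : s.arr 1 = s₀.arr 1
  ord : s.arr 12 = s₀.arr 12

theorem vc_flipProgram_left (hs : SameOrdering s₀ s) (hB : s.reg 3 + 1 ≤ B) :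
    vc B (flipProgram 2 4 3 6 12 7) s fun t s' => t ≤ 10 ∧ SameOrdering s₀ s' ∧
      s'.reg 2 = s.reg 2 ∧ s'.reg 3 = s.reg 3 + 1 ∧ s'.reg 4 = s.reg 4 ∧
      s'.arr 2 = flipMate (s.arr 2) (s.reg 5) (s.reg 6) (s.reg 12) (s.reg 7) ∧
      s'.arr 3 = s.arr 3 ∧ s'.quadruples 4 (s.reg 3 + 1) =
        s.quadruples 4 (s.reg 3) ++ [(s.reg 5, s.reg 6, s.reg 12, s.reg 7)] ∧
      s'.quadruples 8 (s.reg 4) = s.quadruples 8 (s.reg 4) := by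
  simp only [flipProgram, block, vc]
  refine ⟨by simp [hs.reg_one, hB], by simp, ⟨?_, ?_, ?_, ?_, ?_, ?_⟩, ?_, ?_, ?_, ?_, ?_, ?_, ?_⟩
  case refine_12 =>
    rw [State.quadruples_succ, State.quadruples_congr (s' := s)]
    · simp
    · intro i hi
      simp [hi.ne]
  case refine_13 =>
    apply State.quadruples_congr
    intro i hi
    simp
  all_goals simp [hs.reg_zero, hs.reg_one, hs.reg_seventeen, hs.arr_zero, hs.arr_one, hs.ord,
    flipMate]

theorem vc_flipProgram_right (hs : SameOrdering s₀ s) (hB : s.reg 4 + 1 ≤ B) :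
    vc B (flipProgram 3 8 4 7 13 6) s fun t s' => t ≤ 10 ∧ SameOrdering s₀ s' ∧
      s'.reg 2 = s.reg 2 ∧ s'.reg 4 = s.reg 4 + 1 ∧ s'.reg 3 = s.reg 3 ∧
      s'.arr 3 = flipMate (s.arr 3) (s.reg 5) (s.reg 7) (s.reg 13) (s.reg 6) ∧
      s'.arr 2 = s.arr 2 ∧ s'.quadruples 8 (s.reg 4 + 1) =
        s.quadruples 8 (s.reg 4) ++ [(s.reg 5, s.reg 7, s.reg 13, s.reg 6)] ∧
      s'.quadruples 4 (s.reg 3) = s.quadruples 4 (s.reg 3) := by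
  simp only [flipProgram, block, vc]
  refine ⟨by simp [hs.reg_one, hB], by simp, ⟨?_, ?_, ?_, ?_, ?_, ?_⟩, ?_, ?_, ?_, ?_, ?_, ?_, ?_⟩
  case refine_12 =>
    rw [State.quadruples_succ, State.quadruples_congr (s' := s)]
    · simp
    · intro i hi
      simp [hi.ne]
  case refine_13 =>
    apply State.quadruples_congr
    intro i hi
    simp
  all_goals simp [hs.reg_zero, hs.reg_one, hs.reg_seventeen, hs.arr_zero, hs.arr_one, hs.ord,
    flipMate]

/-- The memories `s` and `s'` differ at most in the registers `14`, `15`, `16`, `18`, and those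
after `20`. -/
structure SameBeforeScan (s s' : State) : Prop where
  arr : s'.arr = s.arr
  reg : ∀ x, x < 14 ∨ x = 17 ∨ x = 19 ∨ x = 20 → s'.reg x = s.reg x

theorem vc_scanProgram (hA : IsAdjacencyList A n (s.arr 0) (s.arr 1)) (h1 : s.reg 1 = 1)
    (hu : s.reg 19 < n) (hB : s.arr 0 n + n + 1 ≤ B) :
    vc B scanProgram s fun t s' => t ≤ 10 + 6 * degree s (s.reg 19) ∧ SameBeforeScan s s' ∧
      (A (s.reg 19) (s.reg 20) ∧ s'.reg 16 = 1 ∨ ¬ A (s.reg 19) (s.reg 20) ∧ s'.reg 16 = 0) := by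
  obtain ⟨v, hv⟩ : ∃ v, s.reg 19 = v := ⟨_, rfl⟩
  obtain ⟨x, hx⟩ : ∃ x, s.reg 20 = x := ⟨_, rfl⟩
  have hmono := hA.mono v (hv ▸ hu)
  have hle := hA.le (hv ▸ hu : v < n)
  simp only [scanProgram, block, vc, hv, hx, degree]
  rw [hv] at hu
  refine ⟨by simp [hv, h1]; omega, by omega, ?_⟩
  refine (Terminates.whileLt (fun m s' => SameBeforeScan s s' ∧ s.arr 0 v ≤ s'.reg 14 ∧
    s'.reg 14 ≤ s.arr 0 (v + 1) ∧ s'.reg 15 = s.arr 0 (v + 1) ∧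
    ((∃ j, s.arr 0 v ≤ j ∧ j < s'.reg 14 ∧ s.arr 1 j = x) ∧ s'.reg 16 = 1 ∨
      (¬ ∃ j, s.arr 0 v ≤ j ∧ j < s'.reg 14 ∧ s.arr 1 j = x) ∧ s'.reg 16 = 0) ∧
    m = 6 * (s.arr 0 (v + 1) - s'.reg 14)) ?_ (6 * (s.arr 0 (v + 1) - s.arr 0 v)) _ ?_).mono ?_
  · rintro m s₁ ⟨g1, g2, g3, g4, g5, rfl⟩ hlt
    rw [g4] at hlt
    have e20 : s₁.reg 20 = x := by rw [g1.reg 20 (by omega), hx]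
    have e1 : s₁.reg 1 = 1 := by rw [g1.reg 1 (by omega), h1]
    have hbd : s₁.reg 14 + 1 ≤ B := by omega
    have hsucc : (∃ j, s.arr 0 v ≤ j ∧ j < s₁.reg 14 + 1 ∧ s.arr 1 j = x) ↔
        (∃ j, s.arr 0 v ≤ j ∧ j < s₁.reg 14 ∧ s.arr 1 j = x) ∨ s.arr 1 (s₁.reg 14) = x := by
      constructor
      · rintro ⟨j, hj, hj', hjx⟩
        rcases (Nat.lt_succ_iff.1 hj').eq_or_lt with rfl | hj'
        · exact .inr hjx
        · exact .inl ⟨j, hj, hj', hjx⟩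
      · rintro (⟨j, hj, hj', hjx⟩ | hjx)
        · exact ⟨j, hj, by omega, hjx⟩
        · exact ⟨_, g2, by omega, hjx⟩
    have hreg := g1.reg
    apply terminates_of_vc
    simp only [vc]
    refine ⟨fun hlt' => ⟨?_, _, ⟨⟨?_, ?_⟩, ?_, ?_, ?_, ?_, rfl⟩, ?_⟩, fun hlt' =>
      ⟨fun hlt'' => ⟨?_, _, ⟨⟨?_, ?_⟩, ?_, ?_, ?_, ?_, rfl⟩, ?_⟩,
        fun hlt'' => ⟨by omega, ?_, _, ⟨⟨?_, ?_⟩, ?_, ?_, ?_, ?_, rfl⟩, ?_⟩⟩⟩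
    all_goals simp [g1.arr, e20] at hlt' ⊢
    all_goals try simp [g1.arr, e20] at hlt''
    all_goals try simp only [e1, g4, hsucc]
    all_goals first
      | omega
      | grind
  · refine ⟨⟨?_, ?_⟩, ?_, ?_, ?_, ?_, ?_⟩
    all_goals simp [hv, h1, hmono]
    all_goals grind
  · rintro t s' ⟨m', ⟨g1, g2, g3, g4, g5, g6⟩, hlt, ht⟩
    have : s'.reg 14 = s.arr 0 (v + 1) := by omega
    rw [this, ← hA.mem v hu] at g5
    exact ⟨by omega, g1, g5⟩

theorem vc_ifAdjProgram (hA : IsAdjacencyList A n (s.arr 0) (s.arr 1)) (hs : SameOrdering s₀ s)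
    {u x : ℕ} (hx : x < 14) (hu : s.reg u < n) (hB : s.arr 0 n + n + 1 ≤ B) {p q : Program}
    {Q : ℕ → State → Prop}
    (hp : A (s.reg u) (s.reg x) → ∀ t s', t ≤ 13 + 6 * degree s (s.reg u) → SameOrdering s₀ s' →
      s'.arr = s.arr → (∀ y < 14, s'.reg y = s.reg y) → vc B p s' fun t' => Q (t + t'))
    (hq : ¬ A (s.reg u) (s.reg x) → ∀ t s', t ≤ 13 + 6 * degree s (s.reg u) →
      SameOrdering s₀ s' → s'.arr = s.arr → (∀ y < 14, s'.reg y = s.reg y) →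
      vc B q s' fun t' => Q (t + t')) : vc B (ifAdjProgram u x p q) s Q := by
  simp only [ifAdjProgram, block, vc]
  have hx' : x ≠ 19 := by omega
  refine (vc_scanProgram (n := n) (A := A) (by simpa using hA) (by simpa using hs.reg_one)
    (by simpa using hu) (by simpa using hB)).mono ?_
  rintro t s₁ ⟨ht, hsame, hscan⟩
  have ha : s₁.arr = s.arr := hsame.arr
  have hr : ∀ y, y < 14 ∨ y = 17 → s₁.reg y = s.reg y := by
    intro y hy
    rw [hsame.reg y (by omega), State.reg_setReg, if_neg (by omega), State.reg_setReg,
      if_neg (by omega)]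
  have hs₁ : SameOrdering s₀ s₁ := ⟨(hr 0 (by omega)).trans hs.reg_zero,
    (hr 1 (by omega)).trans hs.reg_one, (hr 17 (by omega)).trans hs.reg_seventeen,
    ha ▸ hs.arr_zero, ha ▸ hs.arr_one, ha ▸ hs.ord⟩
  simp only [State.reg_setReg, if_true, if_neg hx', Nat.reduceEqDiff, if_false, degree,
    State.arr_setReg] at ht hscan
  rw [hs₁.reg_seventeen]
  constructor
  · intro hpos
    refine (hp (hscan.resolve_right (by omega)).1 (1 + (1 + (t + 1))) s₁ (by rw [degree]; omega) hs₁
      ha fun y hy => hr y (.inl hy)).mono fun t' s' h => ?_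
    convert h using 1
    omega
  · intro hpos
    refine (hq (hscan.resolve_left (by omega)).1 (1 + (1 + (t + 1))) s₁ (by rw [degree]; omega) hs₁
      ha fun y hy => hr y (.inl hy)).mono fun t' s' h => ?_
    convert h using 1
    omega

section
variable {V : Type*} {G : SimpleGraph V} {φ : V ↪ ℕ} {B n : ℕ} {M N : G.Subgraph} {s₀ s s' : State}

/-- The progress stored in a memory. -/
def State.IsProgress (φ : V ↪ ℕ) (n : ℕ) (M N : G.Subgraph) (s : State) : Prop :=
  IntervalFlip.IsProgress φ n M N (s.arr 2) (s.arr 3) (s.quadruples 4 (s.reg 3))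
    (s.quadruples 8 (s.reg 4))

theorem State.IsProgress.congr (h : s.IsProgress φ n M N) (ha : s'.arr = s.arr)
    (h3 : s'.reg 3 = s.reg 3) (h4 : s'.reg 4 = s.reg 4) : s'.IsProgress φ n M N := by
  simpa only [IsProgress, quadruples, ha, h3, h4] using h

theorem State.IsProgress.reg_add_reg_le (h : s.IsProgress φ n M N) : s.reg 3 + s.reg 4 ≤ n := by
  have := h.length_le
  simp only [quadruples, List.length_map, List.length_range] at this
  omega

/-- The memory `s'` arises from `s` by a flip after which the partners of the vertex in register
`5` and of the vertex `c` agree. -/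
structure IsAgreement (φ : V ↪ ℕ) (n : ℕ) (M N : G.Subgraph) (s₀ s : State) (c : ℕ)
    (s' : State) : Prop where
  sameOrdering : SameOrdering s₀ s'
  reg_two : s'.reg 2 = s.reg 2
  progress : s'.IsProgress φ n M N
  disagreement_le : ∀ w, disagreement n w (s'.arr 2) (s'.arr 3) + w c ≤
    disagreement n w (s.arr 2) (s.arr 3)
  agree : ∀ u < n, s'.arr 2 u ≠ s'.arr 3 u → s.arr 2 u ≠ s.arr 3 u ∧ u ≠ s.reg 5

theorem State.IsProgress.vc_flip_left (hφ : ∀ i, i < n ↔ ∃ v, φ v = i)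
    (hp : s.IsProgress φ n M N) (hs : SameOrdering s₀ s) (hz : s.reg 5 < n)
    (h6 : s.reg 6 = s.arr 2 (s.reg 5)) (h7 : s.reg 7 = s.arr 3 (s.reg 5))
    (h12 : s.reg 12 = s.arr 2 (s.reg 7)) (hne : s.reg 6 ≠ s.reg 7)
    (hadj : (G.map φ).Adj (s.reg 6) (s.reg 12)) (hB : n + 1 ≤ B) :
    vc B (flipProgram 2 4 3 6 12 7) s fun t s' =>
      t ≤ 10 ∧ IsAgreement φ n M N s₀ s (s.reg 7) s' := by
  have hle := hp.reg_add_reg_le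
  have hH := adj_lt (G := G) hφ
  rw [h6, h7] at hne
  refine (vc_flipProgram_left hs (by omega)).mono fun t s' h => ?_
  obtain ⟨ht, g1, g2, g3, g4, g5, g6, g7, g8⟩ := h
  rw [h12, h7, h6] at g5
  have hp' := IntervalFlip.IsProgress.flip hφ hp hz hne (by rwa [← h7, ← h12, ← h6])
  refine ⟨ht, g1, g2, ?_, ?_, ?_⟩
  · rw [IsProgress, g3, g4, g5, g6, g7, g8, h12, h7, h6]
    exact hp'
  · intro w
    rw [g5, g6, h7]
    exact hp.left.disagreement_flip hH hp.right hz hne w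
  · intro u hu hu'
    rw [g5, g6] at hu'
    have := hp.left.flip_agree hH hp.right hz hne hu hu'
    exact ⟨this.1, this.2.1⟩

theorem State.IsProgress.vc_flip_right (hφ : ∀ i, i < n ↔ ∃ v, φ v = i)
    (hp : s.IsProgress φ n M N) (hs : SameOrdering s₀ s) (hz : s.reg 5 < n)
    (h6 : s.reg 6 = s.arr 2 (s.reg 5)) (h7 : s.reg 7 = s.arr 3 (s.reg 5))
    (h13 : s.reg 13 = s.arr 3 (s.reg 6)) (hne : s.reg 6 ≠ s.reg 7)
    (hadj : (G.map φ).Adj (s.reg 7) (s.reg 13)) (hB : n + 1 ≤ B) :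
    vc B (flipProgram 3 8 4 7 13 6) s fun t s' =>
      t ≤ 10 ∧ IsAgreement φ n M N s₀ s (s.reg 6) s' := by
  have hle := hp.reg_add_reg_le
  have hH := adj_lt (G := G) hφ
  rw [h6, h7] at hne
  refine (vc_flipProgram_right hs (by omega)).mono fun t s' h => ?_
  obtain ⟨ht, g1, g2, g3, g4, g5, g6, g7, g8⟩ := h
  rw [h13, h7, h6] at g5
  have hp' := (IntervalFlip.IsProgress.flip hφ hp.symm hz hne.symm
    (by rwa [← h6, ← h13, ← h7])).symm
  refine ⟨ht, g1, g2, ?_, ?_, ?_⟩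
  · rw [IsProgress, g3, g4, g5, g6, g7, g8, h13, h7, h6]
    exact hp'
  · intro w
    rw [g5, g6, h6, disagreement_comm, disagreement_comm (f := s.arr 2)]
    exact hp.right.disagreement_flip hH hp.left hz hne.symm w
  · intro u hu hu'
    rw [g5, g6] at hu'
    have := hp.right.flip_agree hH hp.left hz hne.symm hu hu'.symm
    exact ⟨this.1.symm, this.2.1⟩

/-- The vertex `c` is the partner of the treated vertex that agrees after the flip. It is either the
scanned vertex or the partner with the larger degree, so its degree bounds the scan. -/
theorem vc_agreeProgram (hφ : ∀ i, i < n ↔ ∃ v, φ v = i)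
    (hA : IsAdjacencyList (G.map φ).Adj n (s₀.arr 0) (s₀.arr 1))
    (hp : s.IsProgress φ n M N) (hs : SameOrdering s₀ s) (hz : s.reg 5 < n)
    (h6 : s.reg 6 = s.arr 2 (s.reg 5)) (h7 : s.reg 7 = s.arr 3 (s.reg 5))
    (hne : s.reg 6 ≠ s.reg 7) {P : ℕ → Prop} (hP : IsSimple (G.map φ).Adj P (s.reg 5))
    (hfg : ∀ u < n, s.arr 2 u ≠ s.arr 3 u → P u) (hB : s₀.arr 0 n + n + 1 ≤ B) :
    vc B agreeProgram s fun t s' =>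
      ∃ c, t ≤ 40 + 6 * degree s₀ c ∧ IsAgreement φ n M N s₀ s c s' := by
  have hH := adj_lt (G := G) hφ
  have hA' : IsAdjacencyList (G.map φ).Adj n (s.arr 0) (s.arr 1) := by
    rwa [hs.arr_zero, hs.arr_one]
  have h6n : s.reg 6 < n := h6 ▸ hH _ _ (hp.left _ hz).1.symm
  have h7n : s.reg 7 < n := h7 ▸ hH _ _ (hp.right _ hz).1.symm
  have hflip := hp.left.exists_flip hH hp.right hz hP hfg (by rwa [← h6, ← h7])
  rw [← h6, ← h7] at hflip
  have hB' : s.arr 0 n + n + 1 ≤ B := by rwa [hs.arr_zero]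
  have hdeg : ∀ v, degree s₀ v = s.arr 0 (v + 1) - s.arr 0 v := fun v => by
    rw [degree, hs.arr_zero]
  simp only [agreeProgram, block, vc]
  refine ⟨by simp [hs.reg_one]; omega, by simp [hs.reg_one]; omega, ?_⟩
  generalize hs₁ : ((((((((((s.setReg _ _).setReg _ _).setReg _ _).setReg _ _).setReg _ _).setReg
    _ _).setReg _ _).setReg _ _).setReg _ _).setReg _ _) = s₁
  have ha : s₁.arr = s.arr := by simp [← hs₁]
  have e2 : s₁.reg 2 = s.reg 2 := by simp [← hs₁]
  have e3 : s₁.reg 3 = s.reg 3 := by simp [← hs₁]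
  have e4 : s₁.reg 4 = s.reg 4 := by simp [← hs₁]
  have e5 : s₁.reg 5 = s.reg 5 := by simp [← hs₁]
  have e6 : s₁.reg 6 = s.reg 6 := by simp [← hs₁]
  have e7 : s₁.reg 7 = s.reg 7 := by simp [← hs₁]
  have e9 : s₁.reg 9 = degree s₀ (s.reg 6) := by simp [← hs₁, hdeg, hs.reg_one]
  have e11 : s₁.reg 11 = degree s₀ (s.reg 7) := by simp [← hs₁, hdeg, hs.reg_one]
  have e12 : s₁.reg 12 = s.arr 2 (s.reg 7) := by simp [← hs₁]
  have e13 : s₁.reg 13 = s.arr 3 (s.reg 6) := by simp [← hs₁]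
  have hs₁' : SameOrdering s₀ s₁ := by
    refine ⟨?_, ?_, ?_, ha ▸ hs.arr_zero, ha ▸ hs.arr_one, ha ▸ hs.ord⟩
    all_goals simp [← hs₁, hs.reg_zero, hs.reg_one, hs.reg_seventeen]
  clear hs₁
  have hdeg₁ : degree s₁ = degree s₀ := by
    ext v
    rw [hdeg, degree, ha]
  have hleft : ∀ s₂ : State, SameOrdering s₀ s₂ → s₂.arr = s₁.arr →
      (∀ y < 14, s₂.reg y = s₁.reg y) → (G.map φ).Adj (s.reg 6) (s.arr 2 (s.reg 7)) →
      vc B (flipProgram 2 4 3 6 12 7) s₂ fun t s' =>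
        t ≤ 10 ∧ IsAgreement φ n M N s₀ s (s.reg 7) s' := by
    intro s₂ hs₂ ha₂ hr hadj
    rw [ha] at ha₂
    refine ((hp.congr ha₂ (by rw [hr 3 (by omega), e3])
      (by rw [hr 4 (by omega), e4])).vc_flip_left hφ hs₂ ?_ ?_ ?_ ?_ ?_ ?_ (by omega)).mono ?_
    case refine_7 =>
      rintro t s' ⟨ht, h⟩
      rw [hr 7 (by omega), e7] at h
      exact ⟨ht, h.sameOrdering, by rw [h.reg_two, hr 2 (by omega), e2], h.progress,
        by simpa [ha₂] using h.disagreement_le, by simpa [ha₂, hr, e5] using h.agree⟩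
    all_goals simp only [hr, ha₂, e5, e6, e7, e12, Nat.reduceLT]
    all_goals assumption
  have hright : ∀ s₂ : State, SameOrdering s₀ s₂ → s₂.arr = s₁.arr →
      (∀ y < 14, s₂.reg y = s₁.reg y) → (G.map φ).Adj (s.reg 7) (s.arr 3 (s.reg 6)) →
      vc B (flipProgram 3 8 4 7 13 6) s₂ fun t s' =>
        t ≤ 10 ∧ IsAgreement φ n M N s₀ s (s.reg 6) s' := by
    intro s₂ hs₂ ha₂ hr hadj
    rw [ha] at ha₂
    refine ((hp.congr ha₂ (by rw [hr 3 (by omega), e3])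
      (by rw [hr 4 (by omega), e4])).vc_flip_right hφ hs₂ ?_ ?_ ?_ ?_ ?_ ?_ (by omega)).mono ?_
    case refine_7 =>
      rintro t s' ⟨ht, h⟩
      rw [hr 6 (by omega), e6] at h
      exact ⟨ht, h.sameOrdering, by rw [h.reg_two, hr 2 (by omega), e2], h.progress,
        by simpa [ha₂] using h.disagreement_le, by simpa [ha₂, hr, e5] using h.agree⟩
    all_goals simp only [hr, ha₂, e5, e6, e7, e13, Nat.reduceLT]
    all_goals assumption
  rw [e9, e11]
  constructor
  · intro hlt
    refine vc_ifAdjProgram (n := n) (A := (G.map φ).Adj) (by rwa [ha]) hs₁' (by omega) (by rwa [e7])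
      (by rwa [ha]) (fun hadj t s₂ ht hs₂ ha₂ hr => (hright s₂ hs₂ ha₂ hr ?_).mono ?_)
      (fun hadj t s₂ ht hs₂ ha₂ hr => (hleft s₂ hs₂ ha₂ hr ?_).mono ?_)
    · rwa [e7, e13] at hadj
    · rintro t' s' ⟨ht', h⟩
      rw [e7, hdeg₁] at ht
      exact ⟨_, by omega, h⟩
    · rw [e7, e13] at hadj
      exact hflip.resolve_right hadj
    · rintro t' s' ⟨ht', h⟩
      rw [e7, hdeg₁] at ht
      exact ⟨_, by omega, h⟩
  · intro hlt
    refine vc_ifAdjProgram (n := n) (A := (G.map φ).Adj) (by rwa [ha]) hs₁' (by omega) (by rwa [e6])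
      (by rwa [ha]) (fun hadj t s₂ ht hs₂ ha₂ hr => (hleft s₂ hs₂ ha₂ hr ?_).mono ?_)
      (fun hadj t s₂ ht hs₂ ha₂ hr => (hright s₂ hs₂ ha₂ hr ?_).mono ?_)
    · rwa [e6, e12] at hadj
    · rintro t' s' ⟨ht', h⟩
      rw [e6, hdeg₁] at ht
      exact ⟨_, by omega, h⟩
    · rw [e6, e12] at hadj
      exact hflip.resolve_left hadj
    · rintro t' s' ⟨ht', h⟩
      rw [e6, hdeg₁] at ht
      exact ⟨_, by omega, h⟩

theorem vc_eliminationProgram (hφ : ∀ i, i < n ↔ ∃ v, φ v = i)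
    (hA : IsAdjacencyList (G.map φ).Adj n (s.arr 0) (s.arr 1))
    {l r : ℕ → ℝ} (hm : IsIntervalModel (G.map φ).Adj (· < n) l r)
    (hinv : s.partition.Inv (G.map φ).Adj n n) (h0 : s.reg 0 = n) (h1 : s.reg 1 = 1)
    (hf : IsMate (G.map φ) n (s.arr 2)) (hg : IsMate (G.map φ) n (s.arr 3))
    (hB : s.arr 0 n + n + 1 ≤ B) :
    vc B eliminationProgram s fun t s' => t ≤ 60 * n + 6 * s.arr 0 n + 5 ∧
      s'.reg 1 = 1 ∧ s'.reg 17 = 0 ∧ s'.reg 3 + s'.reg 4 ≤ n ∧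
      IsFlipList φ (s'.quadruples 4 (s'.reg 3) ++ (s'.quadruples 8 (s'.reg 4)).reverse)
        (mateSubgraph φ G (s.arr 2)) (mateSubgraph φ G (s.arr 3)) := by
  have hH := adj_lt (G := G) hφ
  simp only [eliminationProgram, block, vc]
  refine ⟨by omega, by omega, by omega, ?_⟩
  -- All disagreements lie at positions below register `2`, so the next vertex is simple among them.
  -- The budget is a constant per position, plus the degree weight of the remaining disagreements
  -- for the scans.
  refine (Terminates.whileLt (fun m s' => SameOrdering s s' ∧ s'.reg 2 ≤ n ∧
    s'.IsProgress φ n (mateSubgraph φ G (s.arr 2)) (mateSubgraph φ G (s.arr 3)) ∧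
    (∀ u < n, s'.arr 2 u ≠ s'.arr 3 u → s.partition.pos u < s'.reg 2) ∧
    m = 60 * s'.reg 2 + disagreement n (fun u => 6 * degree s u) (s'.arr 2) (s'.arr 3)) ?_
      (60 * n + disagreement n (fun u => 6 * degree s u) (s.arr 2) (s.arr 3)) _ ?_).mono ?_
  · rintro m s₁ ⟨g1, g2, g3, g4, rfl⟩ hlt
    rw [g1.reg_seventeen] at hlt
    have hk : s₁.reg 2 - 1 < n := by omega
    obtain ⟨z, hz⟩ : ∃ z, s.partition.ord (s₁.reg 2 - 1) = z := ⟨_, rfl⟩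
    have hzn : z < n := hz ▸ hinv.ord_lt _ hk
    have hz' : s₁.arr 12 (s₁.reg 2 - 1) = z := by rw [g1.ord]; exact hz
    have hposz : ∀ u < n, s₁.arr 2 u ≠ s₁.arr 3 u → u ≠ z → s.partition.pos u < s₁.reg 2 - 1 := by
      intro u hu hne huz
      have h1 := g4 u hu hne
      have h2 : s.partition.pos u ≠ s₁.reg 2 - 1 := by
        intro heq
        rw [← heq, hinv.ord_pos u hu] at hz
        exact huz hz
      omega
    have hsimple := hinv.isSimple hm (fun _ _ h => h.symm) (fun u => by simp) hk
    rw [hz] at hsimple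
    have key : ∀ s₂ : State, s₂ = (((s₁.setReg 2 (s₁.reg 2 - 1)).setReg 5 z).setReg 6
        (s₁.arr 2 z)).setReg 7 (s₁.arr 3 z) → s₁.arr 2 z ≠ s₁.arr 3 z →
        vc B agreeProgram s₂ fun t s' => ∃ c, t ≤ 40 + 6 * degree s c ∧
          IsAgreement φ n (mateSubgraph φ G (s.arr 2)) (mateSubgraph φ G (s.arr 3)) s s₂ c s' := by
      rintro s₂ rfl hne
      have hsimple' : IsSimple (G.map φ).Adj (fun u => u < n ∧ s.partition.pos u ≤ s₁.reg 2 - 1)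
          (((((s₁.setReg 2 (s₁.reg 2 - 1)).setReg 5 z).setReg 6 (s₁.arr 2 z)).setReg 7
            (s₁.arr 3 z)).reg 5) := by simpa using hsimple
      refine vc_agreeProgram hφ hA (g3.congr (by simp) (by simp) (by simp)) ?_
        (by simpa using hzn) (by simp) (by simp) (by simpa using hne) hsimple'
        (fun u hu hne => ⟨hu, ?_⟩) hB
      · refine ⟨?_, ?_, ?_, ?_, ?_, ?_⟩
        all_goals simp [g1.reg_zero, g1.reg_one, g1.reg_seventeen, g1.arr_zero, g1.arr_one, g1.ord]
      · have := g4 u hu (by simpa using hne)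
        omega
    have hcost : ∀ s₂ : State, s₂ = (((s₁.setReg 2 (s₁.reg 2 - 1)).setReg 5 z).setReg 6
        (s₁.arr 2 z)).setReg 7 (s₁.arr 3 z) → s₁.arr 2 z ≠ s₁.arr 3 z →
        vc B agreeProgram s₂ fun t s' => SameOrdering s s' ∧ s'.reg 2 = s₁.reg 2 - 1 ∧
          s'.IsProgress φ n (mateSubgraph φ G (s.arr 2)) (mateSubgraph φ G (s.arr 3)) ∧
          (∀ u < n, s'.arr 2 u ≠ s'.arr 3 u → s.partition.pos u < s₁.reg 2 - 1) ∧
          t + disagreement n (fun u => 6 * degree s u) (s'.arr 2) (s'.arr 3) ≤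
            40 + disagreement n (fun u => 6 * degree s u) (s₁.arr 2) (s₁.arr 3) := by
      intro s₂ hs₂ hne
      refine (key s₂ hs₂ hne).mono ?_
      rintro t s' ⟨c, ht, h⟩
      have h1 := h.disagreement_le fun u => 6 * degree s u
      have ha : s₂.arr = s₁.arr := by simp [hs₂]
      rw [ha] at h1
      refine ⟨h.sameOrdering, by simp [h.reg_two, hs₂], h.progress, fun u hu hu' => ?_, by omega⟩
      have h2 := h.agree u hu hu'
      rw [ha] at h2
      exact hposz u hu h2.1 (by simpa [hs₂] using h2.2)
    apply terminates_of_vc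
    simp only [vc]
    simp only [State.reg_setReg, State.arr_setReg, g1.reg_one, hz', if_true, Nat.reduceEqDiff,
      if_false]
    refine ⟨fun hlt' => (hcost _ rfl hlt'.ne).mono ?_, fun hlt' => ⟨fun hlt'' =>
      (hcost _ rfl hlt''.ne').mono ?_, fun hlt'' => ?_⟩⟩
    · rintro t s' ⟨k1, k2, k3, k4, k5⟩
      exact ⟨_, ⟨k1, by omega, k3, by rwa [k2], rfl⟩, by omega⟩
    · rintro t s' ⟨k1, k2, k3, k4, k5⟩
      exact ⟨_, ⟨k1, by omega, k3, by rwa [k2], rfl⟩, by omega⟩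
    · have heq : s₁.arr 2 z = s₁.arr 3 z := by omega
      refine ⟨_, ⟨⟨?_, ?_, ?_, ?_, ?_, ?_⟩, ?_, g3.congr (by simp) (by simp) (by simp), ?_, rfl⟩, ?_⟩
      case refine_8 =>
        intro u hu hne
        exact hposz u hu hne (by rintro rfl; exact hne heq)
      all_goals simp [g1.reg_zero, g1.reg_one, g1.reg_seventeen, g1.arr_zero, g1.arr_one, g1.ord]
      all_goals omega
  · refine ⟨⟨?_, ?_, ?_, ?_, ?_, ?_⟩, ?_, ?_, ?_, ?_⟩
    case refine_8 =>
      refine ⟨hf, hg, rfl, rfl, ?_⟩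
      simpa [State.quadruples] using (Finset.card_filter_le (Finset.range n) _)
    all_goals simp [h0, h1]
    exact fun u hu _ => hinv.pos_lt u hu
  · rintro t s' ⟨m', ⟨g1, g2, g3, g4, g5⟩, hlt, ht⟩
    rw [g1.reg_seventeen] at hlt
    have hd : disagreement n (fun u => 6 * degree s u) (s.arr 2) (s.arr 3) ≤ 6 * s.arr 0 n := by
      rw [← hA.sum_degree, Finset.mul_sum]
      exact Finset.sum_le_sum_of_subset (Finset.filter_subset _ _)
    have heq : mateSubgraph φ G (s'.arr 2) = mateSubgraph φ G (s'.arr 3) := by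
      refine mateSubgraph_congr hφ fun u hu => ?_
      by_contra hne
      have := g4 u hu hne
      omega
    refine ⟨by omega, g1.reg_one, g1.reg_seventeen, g3.reg_add_reg_le,
      g3.flips_left.append ?_⟩
    rw [heq]
    exact g3.flips_right.reverse (hg.isPerfectMatching hφ)

end

/-- A flip read backwards is the flip along the same 4-cycle, so the quadruples of the second list
are copied unchanged, last one first. The loop preserves the concatenation of the first list with
the reversed second. -/
theorem vc_outputProgram {B n : ℕ} {s : State} (h1 : s.reg 1 = 1) (h17 : s.reg 17 = 0)
    (hle : s.reg 3 + s.reg 4 ≤ n) (hB : n + 1 ≤ B) :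
    vc B outputProgram s fun t s' => t ≤ 15 * n + 3 ∧ s'.reg 0 = s.reg 3 + s.reg 4 ∧
      s'.quadruples 4 (s.reg 3 + s.reg 4) =
        s.quadruples 4 (s.reg 3) ++ (s.quadruples 8 (s.reg 4)).reverse := by
  simp only [outputProgram, block, vc]
  refine (Terminates.whileLt (fun m s' => s'.reg 1 = 1 ∧ s'.reg 17 = 0 ∧
    s'.reg 3 + s'.reg 4 = s.reg 3 + s.reg 4 ∧
    s'.quadruples 4 (s'.reg 3) ++ (s'.quadruples 8 (s'.reg 4)).reverse =
      s.quadruples 4 (s.reg 3) ++ (s.quadruples 8 (s.reg 4)).reverse ∧ m = 15 * s'.reg 4) ?_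
      (15 * s.reg 4) s ⟨h1, h17, rfl, rfl, rfl⟩).mono ?_
  · rintro m s₁ ⟨g1, g2, g3, g4, rfl⟩ hlt
    rw [g2] at hlt
    obtain ⟨k, hk⟩ : ∃ k, s₁.reg 4 = k + 1 := ⟨s₁.reg 4 - 1, by omega⟩
    apply terminates_of_vc
    simp only [vc]
    refine ⟨by simp [g1]; omega, _, ⟨?_, ?_, ?_, ?_, rfl⟩, ?_⟩
    case refine_4 =>
      rw [← g4, hk, s₁.quadruples_succ]
      simp only [State.reg_setReg, State.reg_setArr, if_true, Nat.reduceEqDiff, if_false, g1, hk,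
        Nat.add_sub_cancel]
      rw [State.quadruples_succ, List.reverse_append, List.append_assoc]
      congr 1
      · apply State.quadruples_congr
        intro i hi
        simp [hi.ne]
      · congr 1
        · simp
    all_goals simp [g1, g2, hk]
    all_goals omega
  · rintro t s' ⟨m', ⟨g1, g2, g3, g4, g5⟩, hlt, ht⟩
    have h4 : s'.reg 4 = 0 := by omega
    rw [h4] at g3 g4
    refine ⟨by omega, by simp; omega, ?_⟩
    rw [← g4, ← g3]
    simp [State.quadruples]

/-- The program that finds a reconfiguration sequence between two perfect matchings of an interval
graph. -/
def reconfigurationProgram : Program := block [lexBFSProgram, eliminationProgram, outputProgram]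

/-! ### From the input format to the theorem -/

section
variable {n : ℕ} {G : SimpleGraph (Fin n)} {M N : G.Subgraph} {s : State}

theorem lt_iff_exists_valEmbedding (i : ℕ) : i < n ↔ ∃ v : Fin n, Fin.valEmbedding v = i :=
  ⟨fun h => ⟨⟨i, h⟩, rfl⟩, by rintro ⟨v, rfl⟩; exact v.isLt⟩

theorem IsInput.isAdjacencyList (h : IsInput M N s) :
    IsAdjacencyList (G.map Fin.valEmbedding).Adj n (s.arr 0) (s.arr 1) where
  off_zero := h.off_zero
  mono v hv := h.off_mono ⟨v, hv⟩
  inj v hv j hj hj' k hk hk' heq := (h.adj ⟨v, hv⟩).injOn ⟨hj, hj'⟩ ⟨hk, hk'⟩ heq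
  mem v hv w := by
    have h1 := (h.adj ⟨v, hv⟩).image_eq
    have h2 : w ∈ (fun w : Fin n => (w : ℕ)) '' G.neighborSet ⟨v, hv⟩ ↔
        (G.map Fin.valEmbedding).Adj v w := by
      rw [SimpleGraph.map_adj]
      constructor
      · rintro ⟨w, hw, rfl⟩
        exact ⟨⟨v, hv⟩, w, hw, rfl, rfl⟩
      · rintro ⟨v', w', hvw, rfl, rfl⟩
        exact ⟨w', hvw, rfl⟩
    rw [← h2, ← h1]
    constructor
    · rintro ⟨j, ⟨hj, hj'⟩, hjw⟩
      exact ⟨j, hj, hj', hjw⟩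
    · rintro ⟨j, hj, hj', hjw⟩
      exact ⟨j, ⟨hj, hj'⟩, hjw⟩

/-- The handshake lemma, by which bounds in the total length of the adjacency lists become bounds in
the number of edges. -/
theorem IsInput.arr_zero_card (h : IsInput M N s) : s.arr 0 n = 2 * G.edgeSet.ncard := by
  classical
  have h1 : ∀ v : Fin n, degree s v = G.degree v := by
    intro v
    have h2 := congrArg Set.ncard (h.adj v).image_eq
    rw [(h.adj v).injOn.ncard_image,
      Set.ncard_image_of_injective _ Fin.val_injective] at h2
    rw [← SimpleGraph.card_neighborSet_eq_degree, ← Nat.card_eq_fintype_card,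
      Nat.card_coe_set_eq, ← h2, Set.ncard_eq_toFinset_card', Set.toFinset_Ico, Nat.card_Ico, degree]
  rw [← h.isAdjacencyList.sum_degree, ← Fin.sum_univ_eq_sum_range (degree s),
    Finset.sum_congr rfl fun v _ => h1 v, G.sum_degrees_eq_twice_card_edges,
    ← SimpleGraph.coe_edgeFinset, Set.ncard_coe_finset]

theorem IsInput.bounded {B : ℕ} (h : IsInput M N s) (hM : M.IsPerfectMatching)
    (hN : N.IsPerfectMatching) (hB : s.arr 0 n + n ≤ B) : Bounded B s := by
  have hA := h.isAdjacencyList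
  constructor
  · intro x
    by_cases hx : x = 0
    · rw [hx, h.card]
      omega
    · rw [h.reg_zero x hx]
      omega
  · intro a i
    by_cases ha : 4 ≤ a
    · rw [h.arr_rest a ha]
      omega
    interval_cases a
    · rcases lt_or_ge n i with hi | hi
      · rw [h.off_rest i hi]
        omega
      · cases i with
        | zero => rw [h.off_zero]; omega
        | succ i =>
          have := hA.le (v := i) (by omega)
          omega
    · rcases lt_or_ge i (s.arr 0 n) with hi | hi
      · obtain ⟨v, hv, h1, h2⟩ : ∃ v < n, s.arr 0 v ≤ i ∧ i < s.arr 0 (v + 1) := by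
          by_contra hcon
          push Not at hcon
          have : ∀ k ≤ n, s.arr 0 k ≤ i := by
            intro k
            induction k with
            | zero => rw [h.off_zero]; omega
            | succ k ih => exact fun hk => hcon k hk (ih (by omega))
          have := this n le_rfl
          omega
        have h3 := (hA.mem v hv _).2 ⟨i, h1, h2, rfl⟩
        have := adj_lt lt_iff_exists_valEmbedding _ _ h3.symm
        omega
      · rw [h.adj_rest i hi]
        omega
    · rcases lt_or_ge i n with hi | hi
      · obtain ⟨w, hw, -⟩ := hM.1 (hM.2 ⟨i, hi⟩)
        have := h.mate_left ⟨i, hi⟩ w hw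
        simp only at this
        omega
      · rw [h.mate_left_rest i hi]
        omega
    · rcases lt_or_ge i n with hi | hi
      · obtain ⟨w, hw, -⟩ := hN.1 (hN.2 ⟨i, hi⟩)
        have := h.mate_right ⟨i, hi⟩ w hw
        simp only at this
        omega
      · rw [h.mate_right_rest i hi]
        omega

theorem IsInput.vc_reconfigurationProgram {B : ℕ} (h : IsInput M N s)
    (hG : IsIntervalGraph G) (hM : M.IsPerfectMatching) (hN : N.IsPerfectMatching)
    (hB : s.arr 0 n + n + 1 ≤ B) :
    vc B reconfigurationProgram s fun t s' => t ≤ 60 * s.arr 0 n + 120 * n + 60 ∧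
      ∃ q, q ≤ n ∧ s'.reg 0 = q ∧ IsFlipList Fin.valEmbedding (s'.quadruples 4 q) M N := by
  have hφ := lt_iff_exists_valEmbedding (n := n)
  have hA := h.isAdjacencyList
  obtain ⟨l, r, hm⟩ := hG.exists_isIntervalModel hφ
  have hf := isMate_of_isPerfectMatching hφ hM h.mate_left
  have hg := isMate_of_isPerfectMatching hφ hN h.mate_right
  have hMf := eq_mateSubgraph (φ := Fin.valEmbedding) hM h.mate_left
  have hNg := eq_mateSubgraph (φ := Fin.valEmbedding) hN h.mate_right
  simp only [reconfigurationProgram, block, vc]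
  refine (vc_lexBFSProgram hA (fun u v huv => adj_lt hφ _ _ huv.symm) h.card
    (h.arr_rest 16 (by decide)) (h.arr_rest 14 (by decide)) (h.arr_rest 15 (by decide)) hB).mono ?_
  rintro t s₁ ⟨ht, hinv, hin⟩
  refine (vc_eliminationProgram hφ (by rwa [hin.arr_zero, hin.arr_one]) hm hinv
    (hin.reg_zero.trans h.card) hin.reg_one (by rwa [hin.arr_two]) (by rwa [hin.arr_three])
    (by rwa [hin.arr_zero])).mono ?_
  rintro t' s₂ ⟨ht', h1, h17, hle, hL⟩
  refine (vc_outputProgram h1 h17 hle (by omega)).mono ?_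
  rintro t'' s₃ ⟨ht'', h0, hq⟩
  rw [hin.arr_zero] at ht'
  refine ⟨by omega, _, hle, h0, ?_⟩
  rw [hq, hMf, hNg, ← hin.arr_two, ← hin.arr_three]
  exact hL

theorem IsFlipList.exists_isOutput {q : ℕ} (h : IsFlipList Fin.valEmbedding (s.quadruples 4 q) M N)
    (hM : M.IsPerfectMatching) (hq : s.reg 0 = q) : ∃ S : Fin (q + 1) → G.Subgraph,
      IsReconfigurationSequence M N q S ∧ IsOutput q S s := by
  obtain ⟨S, hS, hflip⟩ := h.exists_isReconfigurationSequence hM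
  have hlen : (s.quadruples 4 q).length = q := by simp [State.quadruples]
  generalize hL : s.quadruples 4 q = L at *
  subst hlen
  refine ⟨S, hS, hq, fun i => ?_⟩
  obtain ⟨a, b, c, d, hx, hf⟩ := hflip i
  have : L[i] = (s.arr 4 i, s.arr 5 i, s.arr 6 i, s.arr 7 i) := by
    rw [Fin.getElem_fin, List.getElem_of_eq hL.symm i.isLt]
    simp [State.quadruples]
  rw [this, Prod.mk.injEq, Prod.mk.injEq, Prod.mk.injEq] at hx
  exact ⟨a, b, c, d, hx.1, hx.2.1, hx.2.2.1, hx.2.2.2, hf⟩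

end

end IntervalFlip

theorem mainTheorem9 :
    (∃ C : ℕ, ∀ (V : Type*) [Fintype V] (G : SimpleGraph V), IntervalFlip.IsIntervalGraph G →
      ∀ M N : G.Subgraph, M.IsPerfectMatching → N.IsPerfectMatching →
        ∃ (q : ℕ) (S : Fin (q + 1) → G.Subgraph),
          IntervalFlip.IsReconfigurationSequence M N q S ∧ q ≤ C * Fintype.card V) ∧
    (∃ (p : IntervalFlip.Program) (C : ℕ),
      ∀ (n : ℕ) (G : SimpleGraph (Fin n)), IntervalFlip.IsIntervalGraph G →
      ∀ M N : G.Subgraph, M.IsPerfectMatching → N.IsPerfectMatching →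
      ∀ s : IntervalFlip.State, IntervalFlip.IsInput M N s →
        ∃ (t : ℕ) (s' : IntervalFlip.State),
          IntervalFlip.Exec (C * (n + G.edgeSet.ncard + 1)) p s t s' ∧
          t ≤ C * (n + G.edgeSet.ncard + 1) ∧
          ∃ (q : ℕ) (S : Fin (q + 1) → G.Subgraph),
            IntervalFlip.IsReconfigurationSequence M N q S ∧ q ≤ C * n ∧
            IntervalFlip.IsOutput q S s') := by
  -- With total list length `2m` the running time is at most `120 m + 120 n + 60`, hence the
  -- constant 120; it also covers the word bound `2m + n + 1`.
  refine ⟨⟨1, fun V _ G hG M N hM hN => ?_⟩, IntervalFlip.reconfigurationProgram, 120,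
    fun n G hG M N hM hN s hs => ?_⟩
  · simpa using IntervalFlip.exists_isReconfigurationSequence hG hM hN
  · have hm := hs.arr_zero_card
    obtain ⟨t, s', he, -, ht, q, hq, h0, hL⟩ := IntervalFlip.terminates_of_vc
      (hs.vc_reconfigurationProgram (B := 120 * (n + G.edgeSet.ncard + 1)) hG hM hN
        (by omega)) (hs.bounded hM hN (by omega))
    obtain ⟨S, hS, hout⟩ := hL.exists_isOutput hM h0
    exact ⟨t, s', he, by omega, q, S, hS, by omega, hout⟩
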